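/- Identify a CNOT circuit on $n$ wires with a finite sequence of gates; a gate with control wire $i$ and target wire $j\neq i$ replaces the value of wire $j$ by the sum over $\mathbb F_2$ of the values of wires $i$ and $j$. The size of a circuit is its number of gates. A circuit whose wires are the vertices of a finite simple graph $G$ is a graphic parity network for $G$ if, for every input $x\in\mathbb F_2^{V(G)}$, the final values of the wires equal the input values, and for every edge $uv$ of $G$ there is a point of the circuit at which some wire carries $x_u\oplus x_v$ (for all inputs $x$). There is a randomized algorithm with worst-case running time polynomial in $n$ that, given a graph $G$ with $n$ vertices and $m$ edges, always outputs a graphic parity network for $G$, and whose output has expected size (over the random choices of the algorithm) $$m + O\left(n^{1.5}\sqrt{\log n}\right),$$ where the implied constant is absolute. Moreover, if all but a constant number of vertices have degree $\Omega(n)$, the network output by the same algorithm has expected size $m+O(n\log n)$; that is, for every integer $c_1\ge 0$ and every real $c_2>0$ there is a constant $K$ such that the expected size is at most $m+K\,n\log n$ on every graph $G$ in which at most $c_1$ vertices have degree less than $c_2 n$. -/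

import Mathlib

open scoped BigOperators

/-! ## CNOT circuits and parity networks -/

/-- A CNOT gate on wires `V`: two distinct wires, the control and the target. -/
structure CNOTGate (V : Type) where
  control : V
  target : V
  ne : control ≠ target

/-- A CNOT circuit is a finite sequence of CNOT gates; its size is the length of the list. -/
abbrev CNOTCircuit (V : Type) : Type := List (CNOTGate V)

/-- A CNOT gate adds (over `𝔽₂`) the value of the control wire to the target wire. -/
def CNOTGate.apply {V : Type} [DecidableEq V] (g : CNOTGate V) (x : V → ZMod 2) : V → ZMod 2 :=
  Function.update x g.target (x g.control + x g.target)

/-- The values of the wires after the gates of `C` were applied, from left to right, to `x`. -/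
def CNOTCircuit.run {V : Type} [DecidableEq V] (C : CNOTCircuit V) (x : V → ZMod 2) :
    V → ZMod 2 :=
  C.foldl (fun y g => g.apply y) x

/-- The term `A` appears in `C`: at some point of the circuit, some wire carries
`⊕ a ∈ A, x a`, whatever the input `x` is. -/
def CNOTCircuit.HasTerm {V : Type} [DecidableEq V] (C : CNOTCircuit V) (A : Finset V) : Prop :=
  ∃ D : CNOTCircuit V, D <+: C ∧ ∃ w : V, ∀ x : V → ZMod 2, D.run x w = ∑ a ∈ A, x a

/-- `C` is a parity network for the set family `S`: every member of `S` appears as a term, and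
the final values of the wires are the input values. -/
def CNOTCircuit.IsParityNetwork {V : Type} [DecidableEq V] (C : CNOTCircuit V)
    (S : Set (Finset V)) : Prop :=
  (∀ A ∈ S, C.HasTerm A) ∧ ∀ x : V → ZMod 2, C.run x = x

/-- `C` is a graphic parity network for `G`: a parity network for the family of the
two-element sets `{u, v}` where `uv` is an edge of `G`; there is one wire for each vertex. -/
def CNOTCircuit.IsGraphicParityNetwork {V : Type} [DecidableEq V] (C : CNOTCircuit V)
    (G : SimpleGraph V) : Prop :=
  C.IsParityNetwork {A | ∃ u v : V, G.Adj u v ∧ A = {u, v}}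

/-! ## Randomized random-access machines

Programs over registers and arrays of natural numbers. The only arithmetic operations are
addition and truncated subtraction, so that in `t` steps only numbers with `O(t)` bits more than
the input numbers arise, and polynomial time is the same as polynomial time on (probabilistic)
Turing machines. Randomness comes from fair coins. -/

/-- Arithmetic expressions. -/
inductive RAMExpr : Type
  /-- a constant -/
  | const (k : ℕ)
  /-- the content of register `r` -/
  | reg (r : ℕ)
  /-- the entry of array `a` at a computed index -/
  | entry (a : ℕ) (i : RAMExpr)
  /-- sum -/
  | add (e f : RAMExpr)
  /-- truncated difference -/
  | sub (e f : RAMExpr)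

/-- Programs. -/
inductive RAMProgram : Type
  /-- set register `r` to the value of `e` -/
  | assign (r : ℕ) (e : RAMExpr)
  /-- set the entry of array `a` at the index `i` to the value of `e` -/
  | store (a : ℕ) (i e : RAMExpr)
  /-- set register `r` to the outcome, `0` or `1`, of a fair coin toss -/
  | coin (r : ℕ)
  /-- append the value of `e` to the output -/
  | write (e : RAMExpr)
  /-- do nothing -/
  | skip
  /-- sequential composition -/
  | seq (p q : RAMProgram)
  /-- if `e < f` then `p` else `q` -/
  | ifLt (e f : RAMExpr) (p q : RAMProgram)
  /-- while `e < f` do `p` -/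
  | whileLt (e f : RAMExpr) (p : RAMProgram)

/-- States of the machine: the registers, the arrays, the outcomes of the coin tosses still to
be made, and the output written so far. -/
structure RAMState : Type where
  reg : ℕ → ℕ
  arr : ℕ → ℕ → ℕ
  coins : List Bool
  out : List ℕ

/-- The value of an expression. -/
def RAMExpr.eval (s : RAMState) : RAMExpr → ℕ
  | .const k => k
  | .reg r => s.reg r
  | .entry a i => s.arr a (i.eval s)
  | .add e f => e.eval s + f.eval s
  | .sub e f => e.eval s - f.eval s

/-- `RAMProgram.Exec p s t s'`: started in state `s`, the program `p` halts after exactly `t`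
steps, in state `s'`. Each elementary instruction and each evaluation of a test is one step
(it stands for a number of machine operations that depends only on the program). -/
inductive RAMProgram.Exec : RAMProgram → RAMState → ℕ → RAMState → Prop
  | assign (r : ℕ) (e : RAMExpr) (s : RAMState) :
      Exec (.assign r e) s 1 { s with reg := Function.update s.reg r (e.eval s) }
  | store (a : ℕ) (i e : RAMExpr) (s : RAMState) :
      Exec (.store a i e) s 1
        { s with arr := Function.update s.arr a
                          (Function.update (s.arr a) (i.eval s) (e.eval s)) }
  | coin (r : ℕ) (b : Bool) (l : List Bool) (s : RAMState) (h : s.coins = b :: l) :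
      Exec (.coin r) s 1 { s with reg := Function.update s.reg r b.toNat, coins := l }
  | write (e : RAMExpr) (s : RAMState) :
      Exec (.write e) s 1 { s with out := s.out ++ [e.eval s] }
  | skip (s : RAMState) : Exec .skip s 1 s
  | seq {p q : RAMProgram} {s s' s'' : RAMState} {t t' : ℕ}
      (hp : Exec p s t s') (hq : Exec q s' t' s'') : Exec (.seq p q) s (t + t') s''
  | if_true {e f : RAMExpr} {p q : RAMProgram} {s s' : RAMState} {t : ℕ}
      (h : e.eval s < f.eval s) (hp : Exec p s t s') : Exec (.ifLt e f p q) s (t + 1) s'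
  | if_false {e f : RAMExpr} {p q : RAMProgram} {s s' : RAMState} {t : ℕ}
      (h : ¬ e.eval s < f.eval s) (hq : Exec q s t s') : Exec (.ifLt e f p q) s (t + 1) s'
  | while_true {e f : RAMExpr} {p : RAMProgram} {s s' s'' : RAMState} {t t' : ℕ}
      (h : e.eval s < f.eval s) (hp : Exec p s t s') (hw : Exec (.whileLt e f p) s' t' s'') :
      Exec (.whileLt e f p) s (t + t' + 1) s''
  | while_false {e f : RAMExpr} {p : RAMProgram} {s : RAMState}
      (h : ¬ e.eval s < f.eval s) : Exec (.whileLt e f p) s 1 s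

/-! ## Graphs as inputs and circuits as outputs -/

/-- The initial state on input `G` when the coin tosses will show `coins`: register `0` holds
the number `n` of vertices, array `0` holds the adjacency matrix row by row, and everything else
is zero or empty. -/
def RAMState.init {n : ℕ} (G : SimpleGraph (Fin n)) [DecidableRel G.Adj] (coins : List Bool) :
    RAMState where
  reg r := if r = 0 then n else 0
  arr a k := if a = 0 ∧ ∃ i j : Fin n, G.Adj i j ∧ k = (i : ℕ) * n + (j : ℕ) then 1 else 0
  coins := coins
  out := []

/-- A circuit written as the sequence `control, target, control, target, …`. -/
def CNOTCircuit.encode {n : ℕ} (C : CNOTCircuit (Fin n)) : List ℕ :=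
  C.flatMap fun g => [(g.control : ℕ), (g.target : ℕ)]

/-- On input `G` and coin tosses `coins`, the program `P` halts within `t` steps and its output
is the circuit `C`. -/
def RAMProgram.OutputsWithin (P : RAMProgram) {n : ℕ} (G : SimpleGraph (Fin n))
    [DecidableRel G.Adj] (coins : List Bool) (t : ℕ) (C : CNOTCircuit (Fin n)) : Prop :=
  ∃ t' ≤ t, ∃ s : RAMState, P.Exec (RAMState.init G coins) t' s ∧ s.out = C.encode

/-- The expected size of the circuit `C ω` for the outcome `ω` of `R` independent fair coin
tosses. -/
noncomputable def expectedSize {V : Type} {R : ℕ} (C : (Fin R → Bool) → CNOTCircuit V) : ℝ :=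
  𝔼 ω : Fin R → Bool, ((C ω).length : ℝ)

/-! ## The sweep -/

/-! Treat the vertices one by one in some order. Between treatments a treated wire carries its input
value, and an untreated wire `w` carries `x w + x i`, where `i` is the most recently treated
neighbour of `w` (just `x w` if there is none). To treat `v`, one gate from its own last neighbour
turns wire `v` back to `x v`. Then each untreated neighbour `w` has to pass from `x w + x i` to `x w
+ x v`. All `w` with the same `i` are served together: add wire `i` to `v`, add `v` to each of them,
add `i` to `v` again. So the term of an edge appears when its earlier endpoint is treated, and at
the end every wire is restored. The cost is one gate per edge, at most one per vertex, and two per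
link, a pair `(i, v)` of consecutive neighbours of some `w` (`isGraphicParityNetwork_network`,
`length_network_le`).

It remains to count links. Cut the order into blocks of length `s`. A link joins equal or adjacent
blocks, and there are few such pairs, or it is a jump of some `w`; the jumps of one `w` end in
distinct blocks (`card_links_le`). With `s` about `√n` every order has `O(n ^ 1.5)` links, so the
first bound holds for each outcome of the coins.

For the second bound the order comes from independent uniform labels below the least power of two
that is at least `n`, and the blocks are label intervals of length about `4 log n / c₂`. The pairs
in equal or adjacent blocks number `O(n log n)` on average. The neighbours of a vertex of degree at
least `c₂ n` miss a given full block with probability at most `n⁻²`; if they miss none, the vertex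
has no jumps. Each of the at most `c₁` other vertices has at most `n` jumps
(`expect_card_links_le`).

Finally a register program is shown to carry out this sweep step by step, in time `O(n ^ 4)`. -/

namespace CNOTCircuit

/-- The circuit consisting of the gate with control `a` and target `b`, empty if `a = b`. -/
def gate {V : Type} [DecidableEq V] (a b : V) : CNOTCircuit V :=
  if h : a ≠ b then [⟨a, b, h⟩] else []

lemma run_append {V : Type} [DecidableEq V] (C D : CNOTCircuit V) (x : V → ZMod 2) :
    CNOTCircuit.run (C ++ D) x = D.run (C.run x) := by
  simp [CNOTCircuit.run, List.foldl_append]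

lemma run_nil {V : Type} [DecidableEq V] (x : V → ZMod 2) :
    CNOTCircuit.run ([] : CNOTCircuit V) x = x := rfl

lemma run_gate {V : Type} [DecidableEq V] {a b : V} (h : a ≠ b) (x : V → ZMod 2) :
    (gate a b).run x = Function.update x b (x a + x b) := by
  simp [gate, h, CNOTCircuit.run, CNOTGate.apply]

lemma gate_self {V : Type} [DecidableEq V] (a : V) : gate a a = [] := by
  simp [gate]

lemma length_gate_le {V : Type} [DecidableEq V] (a b : V) : (gate a b).length ≤ 1 := by
  unfold gate; split <;> simp

lemma HasTerm.append {V : Type} [DecidableEq V] {C : CNOTCircuit V} {A : Finset V}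
    (h : C.HasTerm A) (D : CNOTCircuit V) : CNOTCircuit.HasTerm (C ++ D) A := by
  obtain ⟨E, hE, w, hw⟩ := h
  exact ⟨E, hE.trans (List.prefix_append _ _), w, hw⟩

/-- Adding one control to a list of targets. -/
lemma run_flatMap_gate {V : Type} [DecidableEq V] (v : V) (W : List V) (hv : v ∉ W)
    (hW : W.Nodup) (y : V → ZMod 2) :
    CNOTCircuit.run (W.flatMap (gate v)) y = fun w => if w ∈ W then y v + y w else y w := by
  induction W generalizing y with
  | nil => simp [run_nil]
  | cons a W ih =>
    simp only [List.mem_cons, not_or, List.nodup_cons] at hv hW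
    rw [List.flatMap_cons, run_append, ih hv.2 hW.2, run_gate hv.1]
    funext w
    by_cases h1 : w = a
    · subst h1; simp [hW.1]
    · simp [h1, Function.update_of_ne hv.1]

end CNOTCircuit

/-- The data of a sweep over the vertices: for each vertex its most recent neighbour among the
vertices treated so far, whether it was treated itself, and the circuit so far. -/
structure Sweep (n : ℕ) where
  last : Fin n → Option (Fin n)
  done : Fin n → Bool
  circuit : CNOTCircuit (Fin n)

/-! ### The sweep: invariant, correctness and size in terms of links -/

namespace Sweep

open CNOTCircuit

/-- The empty sweep. -/
def start (n : ℕ) : Sweep n := ⟨fun _ => none, fun _ => false, []⟩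

/-- The value of `last` served in round `i` of the treatment of `v`. -/
def key {n : ℕ} (v i : Fin n) : Option (Fin n) := if i = v then none else some i

/-- The index `v` is free to encode "no neighbour yet", since `v` is never the last neighbour of
anything before its own treatment. Injectivity makes the guest lists of different rounds disjoint.
-/
lemma key_injective {n : ℕ} (v : Fin n) : Function.Injective (key v) := by
  intro i j h
  unfold key at h
  grind

/-- `i` is the most recent neighbour of `w` at time `k`. -/
def IsLast {n : ℕ} (G : SimpleGraph (Fin n)) (pos : Fin n → ℕ) (w : Fin n) (k : ℕ) (i : Fin n) : Prop :=
  G.Adj w i ∧ pos i < k ∧ ∀ u, G.Adj w u → pos u < k → pos u ≤ pos i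

open Classical in
/-- The pairs of vertices that are consecutive neighbours of some vertex. -/
noncomputable def links {n : ℕ} (G : SimpleGraph (Fin n)) (pos : Fin n → ℕ) : Finset (Fin n × Fin n) :=
  Finset.univ.filter fun p => ∃ w, G.Adj w p.2 ∧ IsLast G pos w (pos p.2) p.1

variable {n : ℕ} (G : SimpleGraph (Fin n)) [DecidableRel G.Adj]

/-- The untreated neighbours of `v` whose most recent neighbour is given by `o`. -/
def guests (S : Sweep n) (v : Fin n) (o : Option (Fin n)) : List (Fin n) :=
  (List.finRange n).filter fun w => G.Adj v w ∧ S.done w = false ∧ S.last w = o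

lemma mem_guests {S : Sweep n} {v w : Fin n} {o : Option (Fin n)} :
    w ∈ S.guests G v o ↔ G.Adj v w ∧ S.done w = false ∧ S.last w = o := by
  simp [guests]

/-- Round `i` of the treatment of `v`. -/
def round (S : Sweep n) (v i : Fin n) : CNOTCircuit (Fin n) :=
  (if S.guests G v (key v i) = [] then [] else gate i v) ++
    ((S.guests G v (key v i)).flatMap (gate v) ++
      (if S.guests G v (key v i) = [] then [] else gate i v))

/-- Return the wire of `v` to its input value. -/
def settle (S : Sweep n) (v : Fin n) : Sweep n where
  last := S.last
  done := Function.update S.done v true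
  circuit := S.circuit ++ (S.last v).elim [] (fun u => gate u v)

/-- The treatment of `v`. -/
def treat (S : Sweep n) (v : Fin n) : Sweep n where
  last w := if G.Adj v w then some v else S.last w
  done := (S.settle v).done
  circuit := (S.settle v).circuit ++ (List.finRange n).flatMap ((S.settle v).round G v)

/-- The state of the sweep after the treatment of the vertices at the positions below `k`. -/
structure Valid (pos : Fin n → ℕ) (k : ℕ) (S : Sweep n) : Prop where
  done_iff : ∀ u, S.done u = true ↔ pos u < k
  last_spec : ∀ w i, S.last w = some i → IsLast G pos w k i
  run : ∀ x w, S.circuit.run x w = x w + if S.done w then 0 else (S.last w).elim 0 x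
  term : ∀ u w, G.Adj u w → pos u < k → S.circuit.HasTerm {u, w}
  length : S.circuit.length ≤
    (Finset.univ.filter fun p : Fin n × Fin n =>
      G.Adj p.1 p.2 ∧ pos p.1 < pos p.2 ∧ pos p.1 < k).card + k +
    2 * ((links G pos).filter fun p => pos p.2 < k).card

lemma valid_start (pos : Fin n → ℕ) : Valid G pos 0 (start n) where
  done_iff := by simp [start]
  last_spec := by simp [start]
  run := by simp [start, run_nil]
  term := by simp
  length := by simp [start]

/-- While the guests are served, wire `v` carries `x v + x i`, so `x i` cancels on each guest; the
second gate from `i` restores wire `v`. For `i = v` the guests have no `x i` to remove, and both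
outer gates are empty. -/
lemma run_round {S : Sweep n} {v i : Fin n} {x y : Fin n → ZMod 2} (hv : y v = x v)
    (hd : ∀ w ∈ S.guests G v (key v i), y w = x w + (S.last w).elim 0 x)
    (hi : ∀ w ∈ S.guests G v (key v i), i ≠ v → S.done i = true ∧ y i = x i) :
    (S.round G v i).run y =
      fun w => if w ∈ S.guests G v (key v i) then x w + x v else y w := by
  have hnd : (S.guests G v (key v i)).Nodup := (List.nodup_finRange n).filter _
  have hvm : v ∉ S.guests G v (key v i) := by simp [mem_guests]
  unfold round
  by_cases hW : S.guests G v (key v i) = []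
  · simp [hW, run_nil]
  simp only [hW, if_false]
  obtain ⟨w₀, hw₀⟩ := List.exists_mem_of_ne_nil _ hW
  by_cases hiv : i = v
  · subst hiv
    rw [gate_self, List.nil_append, List.append_nil, run_flatMap_gate _ _ hvm hnd]
    funext w
    split_ifs with hw
    · have h3 := ((mem_guests G).1 hw).2.2
      rw [hd w hw, h3, hv]; simp [key]; ring
    · rfl
  · have hin : i ∉ S.guests G v (key v i) := fun hm => by
      have h1 := (hi i hm hiv).1
      simp [((mem_guests G).1 hm).2.1] at h1
    rw [run_append, run_append, run_gate hiv, run_flatMap_gate _ _ hvm hnd, run_gate hiv]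
    have h2 : ∀ a b : ZMod 2, a + (a + b) = b := by decide
    have h3 : ∀ a b c : ZMod 2, a + c + (b + a) = b + c := by decide
    funext w
    by_cases hwv : w = v
    · subst hwv
      simp [hvm, hin, hiv, h2]
    · by_cases hw : w ∈ S.guests G v (key v i)
      · have h4 := ((mem_guests G).1 hw).2.2
        simp only [key, hiv, if_false] at h4
        simp [hwv, hw, hd w hw, h4, (hi w hw hiv).2, hv, h3]
      · simp [hwv, hw]

lemma run_rounds {S : Sweep n} {v : Fin n} {x : Fin n → ZMod 2} (I : List (Fin n))
    (hI : I.Nodup) (y : Fin n → ZMod 2) (hv : y v = x v)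
    (hd : ∀ w, ∀ i ∈ I, w ∈ S.guests G v (key v i) → y w = x w + (S.last w).elim 0 x)
    (hi : ∀ i ∈ I, ∀ w ∈ S.guests G v (key v i), i ≠ v → S.done i = true ∧ y i = x i) :
    CNOTCircuit.run (I.flatMap (S.round G v)) y =
      fun w => if ∃ i ∈ I, w ∈ S.guests G v (key v i) then x w + x v else y w := by
  induction I generalizing y with
  | nil => simp [run_nil]
  | cons a I ih =>
    rw [List.nodup_cons] at hI
    have ha := run_round G (S := S) (i := a) hv (fun w hw => hd w a (by simp) hw)
      (fun w hw => hi a (by simp) w hw)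
    have hnot : ∀ w i, i ∈ I → w ∈ S.guests G v (key v i) → w ∉ S.guests G v (key v a) := by
      intro w i hiI hw hwa
      have h1 := ((mem_guests G).1 hw).2.2
      have h2 := ((mem_guests G).1 hwa).2.2
      exact hI.1 (key_injective v (h2.symm.trans h1) ▸ hiI)
    -- The induction hypothesis applies because the first round changes only its own guests: not
    -- `v`, not guests of later rounds, and not the treated vertices used as controls.
    rw [List.flatMap_cons, run_append, ih hI.2]
    · rw [ha]
      funext w
      by_cases h1 : ∃ i ∈ I, w ∈ S.guests G v (key v i)
      · simp [h1]
      · simp [h1]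
    · rw [ha]
      simp [mem_guests, hv]
    · intro w i hiI hw
      rw [ha]
      simp only [hnot w i hiI hw, if_false]
      exact hd w i (by simp [hiI]) hw
    · intro i hiI w hw hiv
      obtain ⟨h1, h2⟩ := hi i (by simp [hiI]) w hw hiv
      refine ⟨h1, ?_⟩
      rw [ha]
      have : i ∉ S.guests G v (key v a) := fun hm => by
        simp [((mem_guests G).1 hm).2.1] at h1
      simp [this, h2]

lemma length_round_le (S : Sweep n) (v i : Fin n) :
    (S.round G v i).length ≤ (S.guests G v (key v i)).length +
      2 * if i ≠ v ∧ S.guests G v (key v i) ≠ [] then 1 else 0 := by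
  have h1 : ((S.guests G v (key v i)).flatMap (gate v)).length ≤
      (S.guests G v (key v i)).length := by
    rw [List.length_flatMap]
    calc _ ≤ ((S.guests G v (key v i)).map (fun _ => 1)).sum :=
          List.sum_le_sum fun w _ => length_gate_le v w
      _ = _ := by simp
  have h2 := length_gate_le i v
  unfold round
  by_cases hW : S.guests G v (key v i) = []
  · simp [hW]
  · by_cases hiv : i = v
    · subst hiv
      simpa [gate_self] using h1
    · simp only [hW, hiv, if_false, List.length_append, ne_eq, not_false_eq_true, and_self,
        if_true]
      omega

lemma length_rounds_le (S : Sweep n) (v : Fin n) :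
    ((List.finRange n).flatMap (S.round G v)).length ≤
      (Finset.univ.filter fun w => G.Adj v w ∧ S.done w = false).card +
      2 * (Finset.univ.filter fun i => i ≠ v ∧ S.guests G v (key v i) ≠ []).card := by
  have h1 : ((List.finRange n).flatMap (S.round G v)).length =
      ∑ i, (S.round G v i).length := by
    rw [List.length_flatMap, ← List.ofFn_eq_map, List.sum_ofFn]
  have h2 : ∑ i, (S.guests G v (key v i)).length ≤
      (Finset.univ.filter fun w => G.Adj v w ∧ S.done w = false).card := by
    have h3 : ∀ i, (S.guests G v (key v i)).length =
        (S.guests G v (key v i)).toFinset.card := fun i =>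
      (List.toFinset_card_of_nodup ((List.nodup_finRange n).filter _)).symm
    simp_rw [h3]
    rw [← Finset.card_biUnion]
    · apply Finset.card_le_card
      intro w hw
      simp only [Finset.mem_biUnion, List.mem_toFinset, mem_guests] at hw
      obtain ⟨i, -, h, h', -⟩ := hw
      simp [h, h']
    · intro i _ j _ hij
      rw [Function.onFun_apply, Finset.disjoint_left]
      intro w hw hw'
      rw [List.mem_toFinset, mem_guests] at hw hw'
      exact hij (key_injective v (hw.2.2.symm.trans hw'.2.2))
  rw [h1]
  refine (Finset.sum_le_sum fun i _ => length_round_le G S v i).trans ?_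
  rw [Finset.sum_add_distrib, ← Finset.mul_sum, Finset.card_filter _ Finset.univ]
  rw [Finset.card_filter] at h2 ⊢
  omega

/-- The core of the invariant: settling clears wire `v`, the rounds move every untreated neighbour
to `x w + x v`, and the new gates are charged to edges leaving `v` forwards, to `v` itself, and to
links ending in `v`. -/
lemma Valid.treat {pos : Fin n → ℕ} (hpos : Function.Injective pos) {k : ℕ} {S : Sweep n}
    (h : Valid G pos k S) {v : Fin n} (hv : pos v = k) : Valid G pos (k + 1) (S.treat G v) := by
  have hdone : ∀ u, (S.settle v).done u = true ↔ pos u < k + 1 := by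
    intro u
    by_cases huv : u = v
    · subst huv; simp [settle, hv]
    · have : pos u ≠ k := fun h' => huv (hpos (h'.trans hv.symm))
      simp only [settle, Function.update_of_ne huv, h.done_iff]
      omega
  have hlastv : ∀ i, S.last v = some i → i ≠ v ∧ S.done i = true := by
    intro i hi
    have := h.last_spec v i hi
    exact ⟨fun h' => by simpa [h'] using this.1, (h.done_iff i).2 this.2.1⟩
  have hvd : S.done v = false := by
    rw [← Bool.not_eq_true, h.done_iff]; omega
  have hsettle : ∀ x w, (S.settle v).circuit.run x w =
      x w + if (S.settle v).done w then 0 else (S.last w).elim 0 x := by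
    intro x w
    simp only [settle]
    rw [run_append]
    rcases hl : S.last v with _ | u
    · simp only [Option.elim_none, run_nil]
      rw [h.run]
      by_cases hwv : w = v
      · subst hwv; simp [hl]
      · simp [hwv]
    · obtain ⟨h1, h2⟩ := hlastv u hl
      simp only [Option.elim_some]
      rw [run_gate h1]
      by_cases hwv : w = v
      · subst hwv
        have h3 : ∀ a b : ZMod 2, a + (b + a) = b := by decide
        simp [h.run, hl, h2, hvd, h3]
      · simp [hwv, h.run]
  have hrun : ∀ x w, (S.treat G v).circuit.run x w = x w +
      if (S.settle v).done w then 0 else ((S.treat G v).last w).elim 0 x := by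
    intro x w
    simp only [Sweep.treat]
    rw [run_append, run_rounds G (x := x) _ (List.nodup_finRange n)]
    · by_cases hw : (S.settle v).done w = true
      · have : ¬ ∃ i ∈ List.finRange n, w ∈ (S.settle v).guests G v (key v i) := by
          rintro ⟨i, -, hi⟩
          have := ((mem_guests G).1 hi).2.1
          simp [hw] at this
        simp only [this, if_false]
        rw [hsettle]; simp [hw]
      · by_cases hadj : G.Adj v w
        · have : ∃ i ∈ List.finRange n, w ∈ (S.settle v).guests G v (key v i) := by
            rcases hl : S.last w with _ | u
            · exact ⟨v, List.mem_finRange _, (mem_guests G).2 ⟨hadj, by simpa using hw, by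
                simpa [key, settle] using hl⟩⟩
            · refine ⟨u, List.mem_finRange _, (mem_guests G).2 ⟨hadj, by simpa using hw, ?_⟩⟩
              have h3 := (h.last_spec w u hl).2.1
              have : u ≠ v := by rintro rfl; omega
              simpa [key, settle, this] using hl
          simp only [this, if_true]
          simp [hw, hadj]
        · have : ¬ ∃ i ∈ List.finRange n, w ∈ (S.settle v).guests G v (key v i) := by
            rintro ⟨i, -, hi⟩
            exact hadj ((mem_guests G).1 hi).1
          simp only [this, if_false]
          rw [hsettle]; simp [hadj]
    · rw [hsettle]; simp [settle]
    · intro w i _ hw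
      rw [hsettle, ((mem_guests G).1 hw).2.1]; simp [settle]
    · intro i _ w hw hiv
      have h1 := ((mem_guests G).1 hw).2.2
      simp only [key, hiv, if_false] at h1
      have h2 := (h.last_spec w i h1).2.1
      have h3 := (hdone i).2 (by omega)
      refine ⟨h3, ?_⟩
      rw [hsettle]; simp [h3]
  refine ⟨hdone, ?_, hrun, ?_, ?_⟩
  · intro w i hi
    by_cases hadj : G.Adj v w
    · simp only [Sweep.treat, hadj, if_true, Option.some.injEq] at hi
      subst hi
      exact ⟨hadj.symm, by omega, fun u _ hu => by omega⟩
    · simp only [Sweep.treat, hadj, if_false] at hi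
      obtain ⟨h1, h2, h3⟩ := h.last_spec w i hi
      refine ⟨h1, by omega, fun u hu huk => h3 u hu ?_⟩
      have : u ≠ v := by rintro rfl; exact hadj hu.symm
      have : pos u ≠ k := fun h' => this (hpos (h'.trans hv.symm))
      omega
  · have hpre : S.circuit <+: (S.treat G v).circuit :=
      (List.prefix_append _ _).trans (List.prefix_append _ _)
    have hterm : ∀ w, G.Adj v w → (S.treat G v).circuit.HasTerm {v, w} := by
      intro w hadj
      -- An edge to an earlier `w` got its term when `w` was treated; for a later `w`, wire `w`
      -- carries the term at the end of the treatment of `v`.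
      by_cases hw : pos w < k
      · rw [Finset.pair_comm]
        obtain ⟨D, hD, a⟩ := h.term w v hadj.symm hw
        exact ⟨D, hD.trans hpre, a⟩
      · refine ⟨_, List.prefix_refl _, w, fun x => ?_⟩
        have : pos w ≠ k := fun h' => hadj.ne (hpos (hv.trans h'.symm))
        have hd : ¬ (S.settle v).done w = true := by rw [hdone]; omega
        rw [hrun, Finset.sum_pair hadj.ne]
        simp [hd, Sweep.treat, hadj, add_comm]
    intro u w huw hu
    by_cases huv : u = v
    · subst huv; exact hterm w huw
    · have : pos u ≠ k := fun h' => huv (hpos (h'.trans hv.symm))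
      obtain ⟨D, hD, a⟩ := h.term u w huw (by omega)
      exact ⟨D, hD.trans hpre, a⟩
  · have hlen := h.length
    have h1 : (S.settle v).circuit.length ≤ S.circuit.length + 1 := by
      simp only [settle, List.length_append]
      rcases S.last v with _ | u
      · simp
      · simpa using length_gate_le u v
    have h2 := length_rounds_le G (S.settle v) v
    have h3 : (Finset.univ.filter fun p : Fin n × Fin n =>
          G.Adj p.1 p.2 ∧ pos p.1 < pos p.2 ∧ pos p.1 < k).card +
        (Finset.univ.filter fun w => G.Adj v w ∧ (S.settle v).done w = false).card ≤
        (Finset.univ.filter fun p : Fin n × Fin n =>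
          G.Adj p.1 p.2 ∧ pos p.1 < pos p.2 ∧ pos p.1 < k + 1).card := by
      rw [← Finset.card_map (Function.Embedding.sectR v (Fin n)), ← Finset.card_union_of_disjoint]
      · apply Finset.card_le_card
        rintro ⟨a, b⟩ hp
        simp only [Finset.mem_union, Finset.mem_filter, Finset.mem_univ, true_and,
          Finset.mem_map, Function.Embedding.sectR_apply, Prod.mk.injEq] at hp ⊢
        rcases hp with hp | ⟨w, ⟨h4, h5⟩, rfl, rfl⟩
        · exact ⟨hp.1, hp.2.1, by omega⟩
        · rw [← Bool.not_eq_true, hdone] at h5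
          exact ⟨h4, by omega, by omega⟩
      · rw [Finset.disjoint_left]
        rintro ⟨a, b⟩ hp hq
        simp only [Finset.mem_filter, Finset.mem_univ, true_and,
          Finset.mem_map, Function.Embedding.sectR_apply, Prod.mk.injEq] at hp hq
        obtain ⟨w, -, rfl, rfl⟩ := hq
        omega
    have h4 : ((links G pos).filter fun p => pos p.2 < k).card +
        (Finset.univ.filter fun i => i ≠ v ∧ (S.settle v).guests G v (key v i) ≠ []).card ≤
        ((links G pos).filter fun p => pos p.2 < k + 1).card := by
      rw [← Finset.card_map (Function.Embedding.sectL (Fin n) v), ← Finset.card_union_of_disjoint]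
      · apply Finset.card_le_card
        rintro ⟨a, b⟩ hp
        simp only [Finset.mem_union, Finset.mem_filter, Finset.mem_univ, true_and,
          Finset.mem_map, Function.Embedding.sectL_apply, Prod.mk.injEq] at hp ⊢
        rcases hp with hp | ⟨i, ⟨h4, h5⟩, rfl, rfl⟩
        · exact ⟨hp.1, by omega⟩
        · refine ⟨?_, by omega⟩
          obtain ⟨w, hw⟩ := List.exists_mem_of_ne_nil _ h5
          obtain ⟨h6, h7, h8⟩ := (mem_guests G).1 hw
          simp only [key, h4, if_false] at h8
          simp only [links, Finset.mem_filter, Finset.mem_univ, true_and]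
          -- Any guest `w` of the round witnesses that `(i, v)` is a link.
          exact ⟨w, h6.symm, hv ▸ h.last_spec w i h8⟩
      · rw [Finset.disjoint_left]
        rintro ⟨a, b⟩ hp hq
        simp only [Finset.mem_filter, Finset.mem_univ, true_and,
          Finset.mem_map, Function.Embedding.sectL_apply, Prod.mk.injEq] at hp hq
        obtain ⟨w, -, rfl, rfl⟩ := hq
        omega
    simp only [Sweep.treat, List.length_append]
    omega

lemma Valid.foldl {pos : Fin n → ℕ} (hpos : Function.Injective pos) (l : List (Fin n)) (k : ℕ)
    {S : Sweep n} (h : Valid G pos k S) (hl : ∀ j (hj : j < l.length), pos l[j] = k + j) :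
    Valid G pos (k + l.length) (l.foldl (Sweep.treat G) S) := by
  induction l generalizing k S with
  | nil => simpa using h
  | cons a l ih =>
    have h1 := ih (k + 1) (h.treat G hpos (v := a) (hl 0 (by simp)))
      (fun j hj => by
        have := hl (j + 1) (by simpa using hj)
        simp only [List.getElem_cons_succ] at this
        omega)
    simpa [add_assoc, add_comm 1] using h1

/-- The vertices sorted by label, then by index. -/
def order (label : Fin n → ℕ) : List (Fin n) :=
  (List.finRange (n + n)).flatMap fun b : Fin (n + n) =>
    (List.finRange n).filter fun v => label v = (b : ℕ)

lemma mem_order {label : Fin n → ℕ} (hl : ∀ v, label v < n + n) (v : Fin n) :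
    v ∈ order label := by
  simp only [order, List.mem_flatMap, List.mem_filter, List.mem_finRange, true_and,
    decide_eq_true_eq]
  exact ⟨⟨label v, hl v⟩, rfl⟩

lemma nodup_order (label : Fin n → ℕ) : (order label).Nodup := by
  rw [order, List.nodup_flatMap]
  refine ⟨fun b _ => (List.nodup_finRange n).filter _, ?_⟩
  refine List.Pairwise.imp ?_ (List.nodup_iff_pairwise_ne.1 (List.nodup_finRange (n + n)))
  intro a b hab
  rw [Function.onFun, List.disjoint_left]
  intro v hv hv'
  simp only [List.mem_filter, List.mem_finRange, true_and, decide_eq_true_eq] at hv hv'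
  exact hab (Fin.ext (hv.symm.trans hv'))

lemma pairwise_order (label : Fin n → ℕ) :
    (order label).Pairwise fun u v => label u ≤ label v := by
  rw [order, List.pairwise_flatMap]
  constructor
  · intro b _
    refine List.Pairwise.imp_of_mem (R := fun _ _ => True) ?_
      (List.pairwise_of_forall fun _ _ => trivial)
    intro u v hu hv _
    simp only [List.mem_filter, List.mem_finRange, true_and, decide_eq_true_eq] at hu hv
    omega
  · refine (List.pairwise_lt_finRange _).imp ?_
    intro a b hab u hu v hv
    simp only [List.mem_filter, List.mem_finRange, true_and, decide_eq_true_eq] at hu hv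
    have : (a : ℕ) < b := hab
    omega

/-- The position of a vertex in the order given by the labels. -/
def position (label : Fin n → ℕ) (v : Fin n) : ℕ := (order label).idxOf v

lemma length_order {label : Fin n → ℕ} (hl : ∀ v, label v < n + n) :
    (order label).length = n := by
  rw [← List.toFinset_card_of_nodup (nodup_order label)]
  have : (order label).toFinset = Finset.univ := by
    ext v; simp [mem_order hl]
  simp [this]

lemma position_lt {label : Fin n → ℕ} (hl : ∀ v, label v < n + n) (v : Fin n) :
    position label v < n := by
  have := List.idxOf_lt_length_iff.2 (mem_order hl v)
  rwa [length_order hl] at this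

lemma position_injective {label : Fin n → ℕ} (hl : ∀ v, label v < n + n) :
    Function.Injective (position label) := by
  intro u v h
  exact (List.idxOf_inj (mem_order hl u)).1 h

lemma label_le_of_position_lt {label : Fin n → ℕ} (hl : ∀ v, label v < n + n) {u v : Fin n}
    (h : position label u < position label v) : label u ≤ label v := by
  have h1 := List.pairwise_iff_getElem.1 (pairwise_order label) _ _
    (List.idxOf_lt_length_iff.2 (mem_order hl u)) (List.idxOf_lt_length_iff.2 (mem_order hl v)) h
  simpa using h1

/-- The circuit of the complete sweep. -/
def network (label : Fin n → ℕ) : CNOTCircuit (Fin n) :=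
  ((order label).foldl (Sweep.treat G) (start n)).circuit

lemma valid_network {label : Fin n → ℕ} (hl : ∀ v, label v < n + n) :
    Valid G (position label) n ((order label).foldl (Sweep.treat G) (start n)) := by
  have := (valid_start G (position label)).foldl G (position_injective hl) (order label) 0
    (fun j hj => by
      rw [zero_add]
      exact (nodup_order label).idxOf_getElem j hj)
  rwa [length_order hl, zero_add] at this

theorem isGraphicParityNetwork_network {label : Fin n → ℕ} (hl : ∀ v, label v < n + n) :
    (network G label).IsGraphicParityNetwork G := by
  have h := valid_network G hl
  constructor
  · rintro A ⟨u, v, huv, rfl⟩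
    exact h.term u v huv (position_lt hl u)
  · intro x
    funext w
    have := h.run x w
    rwa [(h.done_iff w).2 (position_lt hl w), if_pos rfl, add_zero] at this

theorem length_network_le {label : Fin n → ℕ} (hl : ∀ v, label v < n + n) :
    (network G label).length ≤
      G.edgeFinset.card + n + 2 * (links G (position label)).card := by
  have h := (valid_network G hl).length
  have h1 : (Finset.univ.filter fun p : Fin n × Fin n =>
      G.Adj p.1 p.2 ∧ position label p.1 < position label p.2 ∧ position label p.1 < n).card ≤
      G.edgeFinset.card := by
    refine Finset.card_le_card_of_injOn (fun p => s(p.1, p.2)) ?_ ?_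
    · rintro ⟨a, b⟩ hp
      simp only [Finset.coe_filter, Finset.mem_univ, true_and, Set.mem_ofPred_eq] at hp
      simpa using hp.1
    · rintro ⟨a, b⟩ hp ⟨c, d⟩ hq hpq
      simp only [Finset.coe_filter, Finset.mem_univ, true_and, Set.mem_ofPred_eq] at hp hq
      simp only [Sym2.eq_iff] at hpq
      rcases hpq with ⟨rfl, rfl⟩ | ⟨rfl, rfl⟩
      · rfl
      · omega
  have h2 : ((links G (position label)).filter fun p => position label p.2 < n).card ≤
      (links G (position label)).card := Finset.card_filter_le _ _
  exact h.trans (by omega)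

end Sweep

/-! ### Counting links by cutting the order into blocks -/

namespace Sweep
variable {n : ℕ} (G : SimpleGraph (Fin n))

open Classical in
/-- The neighbours of `w` whose preceding neighbour of `w` lies at least two blocks before, where
`r` is divided into blocks of length `s`. -/
noncomputable def jumps (pos r : Fin n → ℕ) (s : ℕ) (w : Fin n) : Finset (Fin n) :=
  Finset.univ.filter fun v =>
    G.Adj w v ∧ ∃ i, IsLast G pos w (pos v) i ∧ r i / s + 1 < r v / s

/-- The pairs that lie in the same or in consecutive blocks of `r`. -/
def near (r : Fin n → ℕ) (s : ℕ) : Finset (Fin n × Fin n) :=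
  Finset.univ.filter fun p => r p.1 ≤ r p.2 ∧ r p.2 / s ≤ r p.1 / s + 1

variable {G}

lemma IsLast.unique {pos : Fin n → ℕ} (hpos : Function.Injective pos) {w i j : Fin n} {k : ℕ}
    (hi : IsLast G pos w k i) (hj : IsLast G pos w k j) : i = j :=
  hpos (le_antisymm (hj.2.2 i hi.1 hi.2.1) (hi.2.2 j hj.1 hj.2.1))

/-- A link that is not near is a jump of some `w`, and `w` and `v` determine its first vertex. The
function `r` need only be monotone along the order: it is the position in the worst-case bound and
the label in the random one. -/
lemma card_links_le {pos r : Fin n → ℕ} (hpos : Function.Injective pos)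
    (hr : ∀ u v, pos u < pos v → r u ≤ r v) (s : ℕ) :
    (links G pos).card ≤ (near r s).card + ∑ w, (jumps G pos r s w).card := by
  classical
  let f : Fin n → Fin n → Fin n := fun w v =>
    if h : ∃ i, IsLast G pos w (pos v) i then h.choose else v
  have hf : ∀ w v i, IsLast G pos w (pos v) i → f w v = i := by
    intro w v i hi
    have h : ∃ i, IsLast G pos w (pos v) i := ⟨i, hi⟩
    simp only [f, h, dif_pos]
    exact h.choose_spec.unique hpos hi
  have hsub : links G pos ⊆ near r s ∪
      Finset.univ.biUnion fun w => (jumps G pos r s w).image fun v => (f w v, v) := by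
    rintro ⟨i, v⟩ hp
    simp only [links, Finset.mem_filter, Finset.mem_univ, true_and] at hp
    obtain ⟨w, hwv, hl⟩ := hp
    rw [Finset.mem_union]
    by_cases h : r v / s ≤ r i / s + 1
    · left
      simp [near, h, hr i v hl.2.1]
    · right
      simp only [Finset.mem_biUnion, Finset.mem_univ, true_and, Finset.mem_image, Prod.mk.injEq,
        jumps, Finset.mem_filter]
      exact ⟨w, v, ⟨hwv, i, hl, by omega⟩, hf w v i hl, rfl⟩
  refine (Finset.card_le_card hsub).trans ((Finset.card_union_le _ _).trans ?_)
  gcongr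
  refine Finset.card_biUnion_le.trans (Finset.sum_le_sum fun w _ => Finset.card_image_le)

/-- If `u` precedes `v` and both are jumps of `w`, the predecessor of `v` is not before `u`, so `v`
lies in a later block than `u`. Hence each block contains at most one jump. -/
lemma card_jumps_le_div {pos r : Fin n → ℕ} (hpos : Function.Injective pos)
    (hr : ∀ u v, pos u < pos v → r u ≤ r v) (s : ℕ) (w : Fin n) {m : ℕ} (hm : ∀ v, r v ≤ m) :
    (jumps G pos r s w).card ≤ m / s + 1 := by
  rw [← Finset.card_range (m / s + 1)]
  have key : ∀ u ∈ jumps G pos r s w, ∀ v ∈ jumps G pos r s w, pos u < pos v →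
      r u / s < r v / s := by
    intro u hu v hv huv
    simp only [jumps, Finset.mem_filter, Finset.mem_univ, true_and] at hu hv
    obtain ⟨-, i, hi, hlt⟩ := hv
    have h1 := hi.2.2 u hu.1 huv
    have h2 : r u ≤ r i := by
      rcases h1.lt_or_eq with h | h
      · exact hr u i h
      · rw [hpos h]
    have := Nat.div_le_div_right (c := s) h2
    omega
  refine Finset.card_le_card_of_injOn (fun v => r v / s) ?_ ?_
  · intro v _
    simp only [Finset.coe_range, Set.mem_Iio]
    exact Nat.lt_succ_of_le (Nat.div_le_div_right (hm v))
  · intro u hu v hv h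
    simp only at h
    rcases lt_trichotomy (pos u) (pos v) with h1 | h1 | h1
    · have := key u hu v hv h1; omega
    · exact hpos h1
    · have := key v hv u hu h1; omega

/-- If the neighbours of `w` meet all blocks, there are no jumps. -/
lemma jumps_eq_empty {pos r : Fin n → ℕ} (hpos : Function.Injective pos)
    (hr : ∀ u v, pos u < pos v → r u ≤ r v)
    {s B : ℕ} (w : Fin n) (hB : ∀ v, r v < B)
    (hw : ∀ b < B / s, ∃ u, G.Adj w u ∧ r u / s = b) : jumps G pos r s w = ∅ := by
  rw [Finset.eq_empty_iff_forall_notMem]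
  intro v hv
  simp only [jumps, Finset.mem_filter, Finset.mem_univ, true_and] at hv
  obtain ⟨-, i, hi, hlt⟩ := hv
  have h1 := Nat.div_le_div_right (c := s) (hB v).le
  -- The block after that of `i` comes before that of `v`, so it is a full block. A neighbour `u` in
  -- it would lie strictly between the consecutive neighbours `i` and `v`.
  obtain ⟨u, hu, hub⟩ := hw (r i / s + 1) (by omega)
  have hr' : ∀ a b, pos a ≤ pos b → r a / s ≤ r b / s := by
    intro a b hab
    rcases hab.lt_or_eq with h | h
    · exact Nat.div_le_div_right (hr a b h)
    · rw [hpos h]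
  rcases lt_or_ge (pos u) (pos v) with h | h
  · have := hr' u i (hi.2.2 u hu h); omega
  · have := hr' v u h; omega

lemma lt_add_of_div_le {a b s : ℕ} (hs : 0 < s) (h : b / s ≤ a / s + 1) : b < a + 2 * s := by
  have h1 := Nat.lt_div_mul_add hs (a := b)
  have h2 := Nat.div_mul_le_self a s
  have h3 := Nat.mul_le_mul_right s h
  nlinarith

lemma card_near_position_le {pos : Fin n → ℕ} (hpos : Function.Injective pos) {s : ℕ}
    (hs : 0 < s) : (near pos s).card ≤ n * (2 * s) := by
  have h : (near pos s).card = ∑ i, ((near pos s).filter fun p => p.1 = i).card :=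
    Finset.card_eq_sum_card_fiberwise (fun _ _ => Finset.mem_coe.2 (Finset.mem_univ _))
  rw [h]
  calc _ ≤ ∑ i : Fin n, 2 * s := by
        refine Finset.sum_le_sum fun i _ => ?_
        have hc : (Finset.Ico (pos i) (pos i + 2 * s)).card = 2 * s := by simp
        rw [← hc]
        refine Finset.card_le_card_of_injOn (fun p => pos p.2) ?_ ?_
        · rintro ⟨a, v⟩ hp
          simp only [near, Finset.coe_filter, Finset.mem_filter, Finset.mem_univ, true_and,
            Set.mem_ofPred_eq] at hp
          obtain ⟨⟨h1, h2⟩, rfl⟩ := hp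
          simp only [Finset.coe_Ico, Set.mem_Ico]
          exact ⟨h1, lt_add_of_div_le hs h2⟩
        · rintro ⟨a, v⟩ hp ⟨b, u⟩ hq h
          simp only [Finset.coe_filter, Set.mem_ofPred_eq] at hp hq
          exact Prod.ext (hp.2.trans hq.2.symm) (hpos h)
    _ = _ := by simp

/-- The bound on the number of links that holds for every order. -/
lemma card_links_le_sqrt {pos : Fin n → ℕ} (hpos : Function.Injective pos)
    (hlt : ∀ v, pos v < n) : (links G pos).card ≤ 6 * (n * n.sqrt) := by
  rcases Nat.eq_zero_or_pos n with rfl | hn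
  · simp [Finset.eq_empty_of_isEmpty]
  have hs : 0 < n.sqrt := Nat.sqrt_pos.2 hn
  have hr : ∀ u v, pos u < pos v → pos u ≤ pos v := fun _ _ h => h.le
  have h1 := card_links_le hpos hr (G := G) n.sqrt
  have h2 := card_near_position_le hpos hs
  have h3 : ∑ w, (jumps G pos pos n.sqrt w).card ≤ ∑ w : Fin n, (n.sqrt + 3) := by
    refine Finset.sum_le_sum fun w _ => ?_
    refine (card_jumps_le_div hpos hr n.sqrt w (fun v => (hlt v).le)).trans ?_
    -- From `n ≤ q ^ 2 + 2 * q` with `q = n.sqrt`; the total is then at most `2nq + n(q + 3) ≤ 6nq`.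
    have : n / n.sqrt ≤ n.sqrt + 2 := by
      apply Nat.div_le_of_le_mul
      have := Nat.sqrt_le_add n
      nlinarith
    omega
  rw [Finset.sum_const, Finset.card_univ, Fintype.card_fin, smul_eq_mul] at h3
  nlinarith

end Sweep

/-! ### Counting random assignments and reading labels from coins -/

lemma Fin.card_filter_div_eq {B s b : ℕ} (hs : 0 < s) (hb : b < B / s) :
    (Finset.univ.filter fun x : Fin B => (x : ℕ) / s = b).card = s := by
  have h : (b + 1) * s ≤ B := (Nat.mul_le_mul_right s hb).trans (Nat.div_mul_le_self B s)
  have hc : (Finset.Ico (b * s) ((b + 1) * s)).card = s := by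
    rw [Nat.card_Ico, add_mul]; omega
  conv_rhs => rw [← hc]
  rw [← Finset.card_map Fin.valEmbedding]
  congr 1
  ext k
  simp only [Finset.mem_map, Finset.mem_filter, Finset.mem_univ, true_and, Fin.valEmbedding_apply,
    Finset.mem_Ico]
  constructor
  · rintro ⟨x, hx, rfl⟩
    rw [← hx, add_mul, one_mul]
    exact ⟨Nat.div_mul_le_self _ _, Nat.lt_div_mul_add hs⟩
  · rintro ⟨h1, h2⟩
    exact ⟨⟨k, by omega⟩, Nat.div_eq_of_lt_le h1 h2, rfl⟩

/-- If for every assignment at most `c` values of one coordinate make `P` true, then a proportion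
of at most `c / |Λ|` of all assignments satisfies `P`. -/
lemma card_filter_mul_le_of_update {ι Λ : Type} [Fintype ι] [DecidableEq ι] [Fintype Λ]
    (P : (ι → Λ) → Prop) [DecidablePred P] (v : ι) (c : ℕ)
    (h : ∀ f : ι → Λ, (Finset.univ.filter fun a => P (Function.update f v a)).card ≤ c) :
    (Finset.univ.filter P).card * Fintype.card Λ ≤ c * Fintype.card (ι → Λ) := by
  -- Swapping the value at `v` with a spare one is an involution, so resampling one coordinate
  -- preserves the uniform distribution.
  let e : (ι → Λ) × Λ → (ι → Λ) × Λ := fun p => (Function.update p.1 v p.2, p.1 v)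
  have he : Function.Involutive e := by
    rintro ⟨f, a⟩
    simp [e]
  have h1 : ∑ p : (ι → Λ) × Λ, (if P (Function.update p.1 v p.2) then 1 else 0) =
      ∑ p : (ι → Λ) × Λ, if P p.1 then 1 else 0 :=
    Fintype.sum_equiv he.toPerm _ _ fun p => rfl
  rw [Fintype.sum_prod_type, Fintype.sum_prod_type] at h1
  calc _ = ∑ f : ι → Λ, ∑ _a : Λ, (if P f then 1 else 0) := by
        simp only [Finset.sum_const, Finset.card_univ, smul_eq_mul]
        rw [← Finset.mul_sum, Finset.card_filter, mul_comm]
    _ = ∑ f : ι → Λ, (Finset.univ.filter fun a => P (Function.update f v a)).card := by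
        rw [← h1]; simp only [Finset.card_filter]
    _ ≤ ∑ _f : ι → Λ, c := Finset.sum_le_sum fun f _ => h f
    _ = _ := by simp [mul_comm]

/-- The number of assignments whose values on `N` avoid `A`. -/
lemma card_filter_avoid {ι Λ : Type} [Fintype ι] [DecidableEq ι] [Fintype Λ] [DecidableEq Λ]
    (N : Finset ι) (A : Finset Λ) :
    (Finset.univ.filter fun f : ι → Λ => ∀ u ∈ N, f u ∉ A).card * Fintype.card Λ ^ N.card =
      (Fintype.card Λ - A.card) ^ N.card * Fintype.card (ι → Λ) := by
  have h : (Finset.univ.filter fun f : ι → Λ => ∀ u ∈ N, f u ∉ A) =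
      Fintype.piFinset fun u => if u ∈ N then Aᶜ else Finset.univ := by
    ext f
    simp only [Finset.mem_filter, Finset.mem_univ, true_and, Fintype.mem_piFinset]
    refine forall_congr' fun u => ?_
    by_cases hu : u ∈ N <;> simp [hu]
  rw [h, Fintype.card_piFinset]
  have h2 : ∀ u, (if u ∈ N then Aᶜ else (Finset.univ : Finset Λ)).card =
      if u ∈ N then Fintype.card Λ - A.card else Fintype.card Λ := by
    intro u; split_ifs <;> simp [Finset.card_compl]
  simp only [h2, Finset.prod_ite, Finset.prod_const, Finset.filter_mem_eq_inter,
    Finset.univ_inter, Fintype.card_fun]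
  rw [mul_assoc, ← pow_add]
  congr 2
  rw [add_comm, ← Finset.compl_filter]
  simp [Finset.card_compl, Finset.card_le_univ]

/-- Restricting uniformly random bits along an injection gives uniformly random bits. -/
lemma expect_comp_injective {α β : Type} [Fintype α] [DecidableEq α] [Fintype β] [DecidableEq β]
    (e : α → β) (he : Function.Injective e) (F : (α → Bool) → ℝ) :
    𝔼 ω : β → Bool, F (ω ∘ e) = 𝔼 τ : α → Bool, F τ := by
  classical
  let E : (β → Bool) ≃ (α → Bool) × ({b // b ∉ Set.range e} → Bool) :=
    (Equiv.piEquivPiSubtypeProd (fun b => b ∈ Set.range e) (fun _ => Bool)).trans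
      (((Equiv.ofInjective e he).symm.arrowCongr (Equiv.refl Bool)).prodCongr (Equiv.refl _))
  have hE : ∀ ω, (E ω).1 = ω ∘ e := by
    intro ω; funext a; simp [E, Equiv.piEquivPiSubtypeProd, Equiv.arrowCongr]
  rw [Fintype.expect_equiv E (fun ω => F (ω ∘ e)) (fun p => F p.1) (fun ω => by rw [hE])]
  rw [← Finset.univ_product_univ, Finset.expect_product]
  simp

/-- The labels read off from the coins: vertex `v` gets the bits `v * L, …, v * L + L - 1`. -/
def coinLabel {R : ℕ} (n L : ℕ) (ω : Fin R → Bool) (v : Fin n) : ℕ :=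
  ∑ l ∈ Finset.range L, (if h : v * L + l < R then (ω ⟨v * L + l, h⟩).toNat else 0) * 2 ^ l

lemma sum_range_mul_two_pow_lt (c : ℕ → ℕ) (hc : ∀ l, c l ≤ 1) (L : ℕ) :
    ∑ l ∈ Finset.range L, c l * 2 ^ l < 2 ^ L := by
  induction L with
  | zero => simp
  | succ L ih =>
    rw [Finset.sum_range_succ, pow_succ]
    have := Nat.mul_le_mul_right (2 ^ L) (hc L)
    omega

lemma coinLabel_lt {R : ℕ} (n L : ℕ) (ω : Fin R → Bool) (v : Fin n) :
    coinLabel n L ω v < 2 ^ L := by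
  refine sum_range_mul_two_pow_lt _ (fun l => ?_) L
  split_ifs
  · exact Bool.toNat_le _
  · exact zero_le_one

lemma expect_coinLabel {R n L : ℕ} (hR : n * L ≤ R) (F : (Fin n → ℕ) → ℝ) :
    𝔼 ω : Fin R → Bool, F (coinLabel n L ω) =
      𝔼 f : Fin n → Fin (2 ^ L), F (fun v => f v) := by
  have hlt : ∀ (v : Fin n) (l : Fin L), (v : ℕ) * L + l < R := by
    intro v l
    have h1 : ((v : ℕ) + 1) * L ≤ n * L := Nat.mul_le_mul_right L v.2
    have h2 := l.2
    rw [add_mul] at h1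
    omega
  let e : Fin n × Fin L → Fin R := fun p => ⟨p.1 * L + p.2, hlt p.1 p.2⟩
  have he : Function.Injective e := by
    intro p q h
    apply finProdFinEquiv.injective
    ext
    have := Fin.val_eq_of_eq h
    simp only [e] at this
    simp only [finProdFinEquiv_apply_val]
    rw [add_comm, mul_comm, this, add_comm, mul_comm L]
  -- Binary expansion in each row: independent uniform bits become independent uniform labels.
  let D : (Fin n × Fin L → Bool) ≃ (Fin n → Fin (2 ^ L)) :=
    (Equiv.curry (Fin n) (Fin L) Bool).trans
      (Equiv.piCongrRight fun _ =>
        (Equiv.piCongrRight fun _ => finTwoEquiv.symm).trans finFunctionFinEquiv)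
  have hD : ∀ (ω : Fin R → Bool) v, coinLabel n L ω v = (D (ω ∘ e) v : ℕ) := by
    intro ω v
    simp only [D, Equiv.trans_apply, Equiv.piCongrRight_apply, Pi.map_apply,
      finFunctionFinEquiv_apply_val, coinLabel]
    rw [Finset.sum_range]
    refine Finset.sum_congr rfl fun l _ => ?_
    rw [dif_pos (hlt v l)]
    congr 1
    simp only [Equiv.curry_apply, Function.curry, Function.comp, e]
    cases ω ⟨v * L + l, hlt v l⟩ <;> rfl
  have h1 := expect_comp_injective e he (fun τ => F (fun v => (D τ v : ℕ)))
  rw [← Fintype.expect_equiv D (fun τ => F (fun v => (D τ v : ℕ))) _ (fun _ => rfl), ← h1]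
  refine Finset.expect_congr rfl fun ω _ => ?_
  congr 1
  funext v
  exact hD ω v

/-! ### The expected number of links for random labels -/

namespace Sweep

variable {n : ℕ}

/-- Once the label of `i` is fixed, that of `v ≠ i` must fall in a window of `2 * s` values. The
diagonal pairs are always near and give the term `n * B`. -/
lemma sum_card_near_le {B s : ℕ} (hs : 0 < s) :
    (∑ f : Fin n → Fin B, (near (fun v => (f v : ℕ)) s).card) * B ≤
      (n * B + n * n * (2 * s)) * Fintype.card (Fin n → Fin B) := by
  have h1 : ∑ f : Fin n → Fin B, (near (fun v => (f v : ℕ)) s).card =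
      ∑ i : Fin n, ∑ v : Fin n, (Finset.univ.filter fun f : Fin n → Fin B =>
        (f i : ℕ) ≤ f v ∧ (f v : ℕ) / s ≤ (f i : ℕ) / s + 1).card := by
    simp only [near, Finset.card_filter]
    rw [Finset.sum_comm, Fintype.sum_prod_type]
  have h2 : ∀ i v : Fin n, (Finset.univ.filter fun f : Fin n → Fin B =>
        (f i : ℕ) ≤ f v ∧ (f v : ℕ) / s ≤ (f i : ℕ) / s + 1).card * B ≤
      ((if i = v then B else 0) + 2 * s) * Fintype.card (Fin n → Fin B) := by
    intro i v
    by_cases hiv : i = v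
    · rw [if_pos hiv, mul_comm]
      exact Nat.mul_le_mul (Nat.le_add_right _ _) (Finset.card_le_univ _)
    · rw [if_neg hiv, zero_add]
      have := card_filter_mul_le_of_update (fun f : Fin n → Fin B =>
        (f i : ℕ) ≤ f v ∧ (f v : ℕ) / s ≤ (f i : ℕ) / s + 1) v (2 * s) (fun f => by
          have hc : (Finset.Ico (f i : ℕ) (f i + 2 * s)).card = 2 * s := by simp
          conv_rhs => rw [← hc]
          refine Finset.card_le_card_of_injOn (fun a => (a : ℕ)) ?_ Fin.val_injective.injOn
          intro a ha
          simp only [Function.update_self, Function.update_of_ne hiv, Finset.coe_filter,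
            Finset.mem_univ, true_and, Set.mem_ofPred_eq] at ha
          simp only [Finset.coe_Ico, Set.mem_Ico]
          exact ⟨ha.1, lt_add_of_div_le hs ha.2⟩)
      simpa using this
  rw [h1, Finset.sum_mul]
  simp only [Finset.sum_mul]
  calc _ ≤ ∑ i : Fin n, ∑ v : Fin n,
        ((if i = v then B else 0) + 2 * s) * Fintype.card (Fin n → Fin B) :=
        Finset.sum_le_sum fun i _ => Finset.sum_le_sum fun v _ => h2 i v
    _ = _ := by
        simp only [← Finset.sum_mul, Finset.sum_add_distrib, Finset.sum_ite_eq,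
          Finset.mem_univ, if_true, Finset.sum_const, Finset.card_univ, Fintype.card_fin,
          smul_eq_mul]
        ring

/-- The assignments of labels for which the neighbours of `w` miss a block. -/
def gaps (G : SimpleGraph (Fin n)) [DecidableRel G.Adj] (B s : ℕ) (w : Fin n) :
    Finset (Fin n → Fin B) :=
  Finset.univ.filter fun f => ∃ b < B / s, ∀ u ∈ G.neighborFinset w, (f u : ℕ) / s ≠ b

/-- A union bound over the full blocks; each is missed with probability `(1 - s / B) ^ deg w ≤ exp
(-(s / B) * deg w)`. -/
lemma card_gaps_le (G : SimpleGraph (Fin n)) [DecidableRel G.Adj] {B s : ℕ} (hs : 0 < s)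
    (w : Fin n) :
    ((gaps G B s w).card : ℝ) ≤
      B * Real.exp (-(s / B * G.degree w)) * Fintype.card (Fin n → Fin B) := by
  rcases Nat.lt_or_ge B s with hBs | hsB
  · have : (gaps G B s w).card = 0 := by
      simp [gaps, Nat.div_eq_of_lt hBs]
    rw [this]
    simp only [Nat.cast_zero]
    positivity
  have hB : 0 < B := hs.trans_le hsB
  have hB' : (0 : ℝ) < B := by exact_mod_cast hB
  have h1 : ∀ b < B / s, ((Finset.univ.filter fun f : Fin n → Fin B =>
      ∀ u ∈ G.neighborFinset w, (f u : ℕ) / s ≠ b).card : ℝ) ≤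
      Real.exp (-(s / B * G.degree w)) * Fintype.card (Fin n → Fin B) := by
    intro b hb
    have h2 := card_filter_avoid (G.neighborFinset w)
      (Finset.univ.filter fun x : Fin B => (x : ℕ) / s = b)
    simp only [Finset.mem_filter, Finset.mem_univ, true_and] at h2
    rw [Fin.card_filter_div_eq hs hb, Fintype.card_fin, G.card_neighborFinset_eq_degree] at h2
    have h3 := congrArg (Nat.cast (R := ℝ)) h2
    push_cast [Nat.cast_sub hsB] at h3
    have h4 : (B : ℝ) - s ≤ B * Real.exp (-(s / B)) := by
      have := Real.add_one_le_exp (-(s / B : ℝ))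
      calc (B : ℝ) - s = B * (-(s / B) + 1) := by field_simp; ring
        _ ≤ _ := by gcongr
    have h5 : ((B : ℝ) - s) ^ G.degree w ≤
        B ^ G.degree w * Real.exp (-(s / B * G.degree w)) := by
      calc _ ≤ (B * Real.exp (-(s / B))) ^ G.degree w :=
            pow_le_pow_left₀ (sub_nonneg.2 (by exact_mod_cast hsB)) h4 _
        _ = _ := by rw [mul_pow, ← Real.exp_nat_mul]; ring_nf
    refine le_of_mul_le_mul_right ?_ (pow_pos hB' (G.degree w))
    rw [h3]
    calc _ ≤ (B ^ G.degree w * Real.exp (-(s / B * G.degree w))) *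
          (Fintype.card (Fin n → Fin B) : ℝ) := by gcongr
      _ = _ := by ring
  have h2 : gaps G B s w ⊆ (Finset.range (B / s)).biUnion fun b =>
      Finset.univ.filter fun f : Fin n → Fin B =>
        ∀ u ∈ G.neighborFinset w, (f u : ℕ) / s ≠ b := by
    intro f hf
    simpa [gaps] using hf
  calc ((gaps G B s w).card : ℝ) ≤ ((∑ b ∈ Finset.range (B / s),
        (Finset.univ.filter fun f : Fin n → Fin B =>
          ∀ u ∈ G.neighborFinset w, (f u : ℕ) / s ≠ b).card : ℕ) : ℝ) := by
        exact_mod_cast (Finset.card_le_card h2).trans Finset.card_biUnion_le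
    _ ≤ ∑ b ∈ Finset.range (B / s),
        Real.exp (-(s / B * G.degree w)) * Fintype.card (Fin n → Fin B) := by
        rw [Nat.cast_sum]
        exact Finset.sum_le_sum fun b hb => h1 b (Finset.mem_range.1 hb)
    _ = ((B / s : ℕ) : ℝ) *
        (Real.exp (-(s / B * G.degree w)) * Fintype.card (Fin n → Fin B)) := by
        rw [Finset.sum_const, Finset.card_range, nsmul_eq_mul]
    _ ≤ B * (Real.exp (-(s / B * G.degree w)) * Fintype.card (Fin n → Fin B)) := by
        gcongr
        exact Nat.div_le_self _ _
    _ = _ := by ring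

/-- The expected number of links for random labels. -/
theorem expect_card_links_le (G : SimpleGraph (Fin n)) [DecidableRel G.Adj] {B s c₁ : ℕ}
    {c₂ : ℝ} (hn : 0 < n) (hs : 0 < s) (hnB : n ≤ B) (hB : B ≤ n + n) (hc₂ : 0 < c₂)
    (hdeg : (Finset.univ.filter fun v : Fin n => (G.degree v : ℝ) < c₂ * n).card ≤ c₁) :
    𝔼 f : Fin n → Fin B, ((links G (position fun v => (f v : ℕ))).card : ℝ) ≤
      n + 2 * n * s + c₁ * n + 2 * n ^ 3 * Real.exp (-(c₂ * s / 2)) := by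
  have hB0 : 0 < B := hn.trans_le hnB
  have hn' : (0 : ℝ) < n := by exact_mod_cast hn
  have hB' : (0 : ℝ) < B := by exact_mod_cast hB0
  have hnB' : (n : ℝ) ≤ B := by exact_mod_cast hnB
  have hBn' : (B : ℝ) ≤ n + n := by exact_mod_cast hB
  have : Nonempty (Fin n → Fin B) := ⟨fun _ => ⟨0, hB0⟩⟩
  set Ω : ℝ := ((Fintype.card (Fin n → Fin B) : ℕ) : ℝ) with hΩ
  have hΩ0 : 0 < Ω := by rw [hΩ]; exact_mod_cast Fintype.card_pos
  have hl : ∀ (f : Fin n → Fin B) v, (f v : ℕ) < n + n := fun f v => (f v).2.trans_le hB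
  have hr : ∀ (f : Fin n → Fin B) (u v : Fin n), position (fun v => (f v : ℕ)) u <
      position (fun v => (f v : ℕ)) v → (f u : ℕ) ≤ f v :=
    fun f u v h => label_le_of_position_lt (hl f) h
  have hjump : ∀ (f : Fin n → Fin B) w,
      (jumps G (position fun v => (f v : ℕ)) (fun v => (f v : ℕ)) s w).card ≤
        if f ∈ gaps G B s w then n else 0 := by
    intro f w
    split_ifs with hf
    · exact (Finset.card_le_univ _).trans (by simp)
    · rw [jumps_eq_empty (position_injective (hl f)) (hr f) (B := B) w (fun v => (f v).2)]
      · simp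
      · intro b hb
        by_contra hcon
        apply hf
        simp only [gaps, Finset.mem_filter, Finset.mem_univ, true_and]
        exact ⟨b, hb, fun u hu h => hcon ⟨u, by simpa using hu, h⟩⟩
  have hlinks : ∀ f : Fin n → Fin B, (links G (position fun v => (f v : ℕ))).card ≤
      (near (fun v => (f v : ℕ)) s).card + ∑ w, if f ∈ gaps G B s w then n else 0 := fun f =>
    (card_links_le (position_injective (hl f)) (hr f) s).trans
      (Nat.add_le_add_left (Finset.sum_le_sum fun w _ => hjump f w) _)
  have hsum : ∑ f : Fin n → Fin B, ((links G (position fun v => (f v : ℕ))).card : ℝ) ≤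
      (∑ f : Fin n → Fin B, (near (fun v => (f v : ℕ)) s).card : ℕ) +
        ∑ w, (n : ℝ) * (gaps G B s w).card := by
    have h1 : ∑ f : Fin n → Fin B, (links G (position fun v => (f v : ℕ))).card ≤
        ∑ f : Fin n → Fin B, (near (fun v => (f v : ℕ)) s).card +
          ∑ w, n * (gaps G B s w).card := by
      refine (Finset.sum_le_sum fun f _ => hlinks f).trans ?_
      rw [Finset.sum_add_distrib, Finset.sum_comm]
      gcongr with w
      rw [← Finset.sum_filter, Finset.sum_const, smul_eq_mul, mul_comm]
      simp
    exact_mod_cast h1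
  have hnear : ((∑ f : Fin n → Fin B, (near (fun v => (f v : ℕ)) s).card : ℕ) : ℝ) ≤
      (n + 2 * n * s) * Ω := by
    have h1 : ((∑ f : Fin n → Fin B, (near (fun v => (f v : ℕ)) s).card : ℕ) : ℝ) * B ≤
        (n * B + n * n * (2 * s)) * Ω := by
      rw [hΩ]
      exact_mod_cast sum_card_near_le hs
    refine le_of_mul_le_mul_right (h1.trans ?_) hB'
    calc (n * B + n * n * (2 * s)) * Ω ≤ (n * B + n * B * (2 * s)) * Ω := by gcongr
      _ = _ := by ring
  have hgaps : ∀ w, (n : ℝ) * (gaps G B s w).card ≤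
      ((if (G.degree w : ℝ) < c₂ * n then (n : ℝ) else 0) +
        2 * n ^ 2 * Real.exp (-(c₂ * s / 2))) * Ω := by
    intro w
    split_ifs with hw
    · have h1 : ((gaps G B s w).card : ℝ) ≤ Ω := by
        rw [hΩ]; exact_mod_cast Finset.card_le_univ _
      have h2 : 0 ≤ 2 * (n : ℝ) ^ 2 * Real.exp (-(c₂ * s / 2)) := by positivity
      calc (n : ℝ) * (gaps G B s w).card ≤ n * Ω := by gcongr
        _ ≤ _ := by gcongr; linarith
    · rw [not_lt] at hw
      have h1 := card_gaps_le G (B := B) hs w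
      have h2 : c₂ * s / 2 ≤ s / B * G.degree w := by
        calc c₂ * s / 2 = s / (n + n) * (c₂ * n) := by field_simp; ring
          _ ≤ _ := by gcongr
      calc (n : ℝ) * (gaps G B s w).card ≤
          n * (B * Real.exp (-(s / B * G.degree w)) * Ω) := by gcongr
        _ ≤ n * ((n + n) * Real.exp (-(c₂ * s / 2)) * Ω) := by gcongr
        _ = _ := by ring
  rw [Fintype.expect_eq_sum_div_card, div_le_iff₀ hΩ0]
  calc _ ≤ (n + 2 * n * s) * Ω + ∑ w : Fin n,
        ((if (G.degree w : ℝ) < c₂ * n then (n : ℝ) else 0) +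
          2 * n ^ 2 * Real.exp (-(c₂ * s / 2))) * Ω :=
        hsum.trans (add_le_add hnear (Finset.sum_le_sum fun w _ => hgaps w))
    _ = (n + 2 * n * s + (Finset.univ.filter fun v : Fin n => (G.degree v : ℝ) < c₂ * n).card * n
          + 2 * n ^ 3 * Real.exp (-(c₂ * s / 2))) * Ω := by
        rw [← Finset.sum_mul, Finset.sum_add_distrib, ← Finset.sum_filter]
        simp only [Finset.sum_const, Finset.card_univ, Fintype.card_fin, nsmul_eq_mul]
        ring
    _ ≤ _ := by gcongr

end Sweep

/-! ### The size bounds for the random network -/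

namespace Sweep

/-- The output of the algorithm, when the coins show `ω`. -/
def randomNetwork {R n : ℕ} (G : SimpleGraph (Fin n)) [DecidableRel G.Adj] (ω : Fin R → Bool) :
    CNOTCircuit (Fin n) :=
  network G (coinLabel n (Nat.clog 2 n) ω)

lemma two_pow_clog_le (n : ℕ) (hn : 0 < n) : 2 ^ Nat.clog 2 n ≤ n + n := by
  rcases Nat.lt_or_ge 1 n with h | h
  · have h1 := Nat.pow_pred_clog_lt_self (b := 2) (by norm_num) h
    have h2 : 0 < Nat.clog 2 n := Nat.clog_pos (by norm_num) h
    obtain ⟨k, hk⟩ := Nat.exists_eq_succ_of_ne_zero h2.ne'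
    rw [hk, Nat.pred_succ] at h1
    rw [hk, pow_succ]
    omega
  · have : n = 1 := by omega
    subst this; simp

lemma coinLabel_clog_lt {R n : ℕ} (ω : Fin R → Bool) (v : Fin n) :
    coinLabel n (Nat.clog 2 n) ω v < n + n :=
  (coinLabel_lt _ _ _ _).trans_le (two_pow_clog_le n (Nat.pos_of_ne_zero (by
    rintro rfl; exact v.elim0)))

lemma length_eq_zero_of_le_one {n : ℕ} (hn : n ≤ 1) (C : CNOTCircuit (Fin n)) :
    C.length = 0 := by
  rw [List.length_eq_zero_iff, List.eq_nil_iff_forall_not_mem]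
  intro g _
  have : Subsingleton (Fin n) := Fin.subsingleton_iff_le_one.2 hn
  exact g.ne (Subsingleton.elim _ _)

lemma half_le_log {n : ℕ} (hn : 2 ≤ n) : (1 / 2 : ℝ) ≤ Real.log n := by
  have h1 : Real.log 2 ≤ Real.log n := Real.log_le_log (by norm_num) (by exact_mod_cast hn)
  have := Real.log_two_gt_d9
  linarith

theorem length_randomNetwork_le {R n : ℕ} (G : SimpleGraph (Fin n)) [DecidableRel G.Adj]
    (ω : Fin R → Bool) :
    ((randomNetwork G ω).length : ℝ) ≤
      G.edgeFinset.card + 26 * ((n : ℝ) ^ (3 / 2 : ℝ) * √(Real.log n)) := by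
  rcases Nat.lt_or_ge 1 n with hn | hn
  · have h1 := length_network_le G (coinLabel_clog_lt ω)
    have h2 := card_links_le_sqrt (G := G) (position_injective (coinLabel_clog_lt ω))
      (position_lt (coinLabel_clog_lt ω))
    have h3 : ((randomNetwork G ω).length : ℝ) ≤
        G.edgeFinset.card + n + 12 * (n * n.sqrt) := by
      have : (randomNetwork G ω).length ≤ G.edgeFinset.card + n + 12 * (n * n.sqrt) := by
        unfold randomNetwork; omega
      exact_mod_cast this
    have hn1 : (1 : ℝ) ≤ n := by exact_mod_cast hn.le
    have h4 : (n : ℝ) ^ (3 / 2 : ℝ) = n * √n := by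
      rw [Real.sqrt_eq_rpow, show (3 / 2 : ℝ) = 1 + 1 / 2 by norm_num,
        Real.rpow_add (by linarith), Real.rpow_one]
    have h5 : (n.sqrt : ℝ) ≤ √n := Real.nat_sqrt_le_real_sqrt
    have h6 : (1 : ℝ) ≤ √n := Real.one_le_sqrt.2 hn1
    have h7 : (1 / 2 : ℝ) ≤ √(Real.log n) := by
      apply Real.le_sqrt_of_sq_le
      have := half_le_log hn
      norm_num at this ⊢
      linarith
    rw [h4]
    have h8 : (n : ℝ) * n.sqrt ≤ n * √n := by gcongr
    have h9 : (n : ℝ) ≤ n * √n := le_mul_of_one_le_right (by linarith) h6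
    have h10 : (n * √n) * (1 / 2) ≤ (n * √n) * √(Real.log n) := by gcongr
    -- `n + 12 n√n ≤ 13 n√n`, and `√(log n) ≥ 1 / 2` doubles the constant to 26.
    linarith
  · rw [length_eq_zero_of_le_one hn]
    simp only [Nat.cast_zero]
    positivity

theorem expectedSize_randomNetwork_le {R n c₁ : ℕ} {c₂ : ℝ} (G : SimpleGraph (Fin n))
    [DecidableRel G.Adj] (hR : n * Nat.clog 2 n ≤ R) (hc₂ : 0 < c₂)
    (hdeg : (Finset.univ.filter fun v : Fin n => (G.degree v : ℝ) < c₂ * n).card ≤ c₁) :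
    expectedSize (randomNetwork (R := R) G) ≤
      G.edgeFinset.card + (22 + 4 * c₁ + 16 / c₂) * (n * Real.log n) := by
  rcases Nat.lt_or_ge 1 n with hn | hn
  · have hn0 : (0 : ℝ) < n := by exact_mod_cast (by omega : 0 < n)
    have hlog := half_le_log hn
    -- Chosen so that `exp (-(c₂ * s / 2)) ≤ n⁻²`, which reduces the factor `n ^ 3` to `n`.
    set s : ℕ := ⌈4 * Real.log n / c₂⌉₊ with hs
    have hs0 : 0 < s := Nat.ceil_pos.2 (by positivity)
    have hs1 : 4 * Real.log n / c₂ ≤ s := Nat.le_ceil _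
    have hs2 : (s : ℝ) < 4 * Real.log n / c₂ + 1 := Nat.ceil_lt_add_one (by positivity)
    have hE := expect_card_links_le G (B := 2 ^ Nat.clog 2 n) (by omega) hs0
      (Nat.le_pow_clog (by norm_num) n) (two_pow_clog_le n (by omega)) hc₂ hdeg
    have h1 : expectedSize (randomNetwork (R := R) G) ≤ 𝔼 ω : Fin R → Bool,
        ((G.edgeFinset.card : ℝ) + n +
          2 * (links G (position (coinLabel n (Nat.clog 2 n) ω))).card) := by
      refine Finset.expect_le_expect fun ω _ => ?_
      exact_mod_cast length_network_le G (coinLabel_clog_lt ω)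
    rw [Finset.expect_add_distrib, Finset.expect_const Finset.univ_nonempty,
      ← Finset.mul_expect,
      expect_coinLabel hR (fun l => ((links G (position l)).card : ℝ))] at h1
    have hexp : (n : ℝ) ^ 3 * Real.exp (-(c₂ * s / 2)) ≤ n := by
      have h2 : Real.exp (-(c₂ * s / 2)) ≤ ((n : ℝ) ^ 2)⁻¹ := by
        have h3 : 2 * Real.log n ≤ c₂ * s / 2 := by
          rw [div_le_iff₀ hc₂] at hs1; linarith
        calc Real.exp (-(c₂ * s / 2)) ≤ Real.exp (-(2 * Real.log n)) :=
              Real.exp_le_exp.2 (by linarith)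
          _ = _ := by
            rw [Real.exp_neg, two_mul, Real.exp_add, Real.exp_log hn0, sq]
      calc (n : ℝ) ^ 3 * Real.exp (-(c₂ * s / 2)) ≤ n ^ 3 * ((n : ℝ) ^ 2)⁻¹ := by gcongr
        _ = (n : ℝ) := by field_simp
    have h5 : (n : ℝ) ≤ 2 * (n * Real.log n) := by nlinarith
    have h6 : (n : ℝ) * s ≤ n * (4 * Real.log n / c₂ + 1) := by gcongr
    have h7 : (c₁ : ℝ) * n ≤ c₁ * (2 * (n * Real.log n)) := by gcongr
    have h8 : (n : ℝ) * (4 * Real.log n / c₂ + 1) = 4 / c₂ * (n * Real.log n) + n := by ring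
    have h9 : (22 + 4 * c₁ + 16 / c₂) * (n * Real.log n) = 22 * (n * Real.log n) +
      2 * (c₁ * (2 * (n * Real.log n))) + 4 * (4 / c₂ * (n * Real.log n)) := by ring
    rw [h9]
    linarith
  · have h1 : expectedSize (randomNetwork (R := R) G) = 0 := by
      simp [expectedSize, length_eq_zero_of_le_one hn]
    rw [h1]
    have := Real.log_natCast_nonneg n
    positivity

end Sweep

/-! ## Reasoning about programs -/

namespace RAMState

/-- Set a register. -/
def setReg (s : RAMState) (r x : ℕ) : RAMState := { s with reg := Function.update s.reg r x }

/-- Set an array entry. -/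
def setArr (s : RAMState) (a i x : ℕ) : RAMState :=
  { s with arr := Function.update s.arr a (Function.update (s.arr a) i x) }

/-- Append to the output. -/
def emit (s : RAMState) (x : ℕ) : RAMState := { s with out := s.out ++ [x] }

/-- Set the remaining coins. -/
def setCoins (s : RAMState) (l : List Bool) : RAMState := { s with coins := l }

section
variable (s : RAMState) (r x a i k : ℕ) (l : List Bool)

@[simp] lemma reg_setReg : (s.setReg r x).reg k = if k = r then x else s.reg k := by
  simp [setReg, Function.update_apply]
@[simp] lemma arr_setReg : (s.setReg r x).arr = s.arr := rfl
@[simp] lemma out_setReg : (s.setReg r x).out = s.out := rfl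
@[simp] lemma coins_setReg : (s.setReg r x).coins = s.coins := rfl
@[simp] lemma reg_setArr : (s.setArr a i x).reg = s.reg := rfl
@[simp] lemma arr_setArr (b j : ℕ) : (s.setArr a i x).arr b j =
    if b = a ∧ j = i then x else s.arr b j := by
  by_cases h : b = a
  · subst h; simp [setArr, Function.update_apply]
  · simp [setArr, h]
@[simp] lemma out_setArr : (s.setArr a i x).out = s.out := rfl
@[simp] lemma coins_setArr : (s.setArr a i x).coins = s.coins := rfl
@[simp] lemma reg_emit : (s.emit x).reg = s.reg := rfl
@[simp] lemma arr_emit : (s.emit x).arr = s.arr := rfl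
@[simp] lemma out_emit : (s.emit x).out = s.out ++ [x] := rfl
@[simp] lemma coins_emit : (s.emit x).coins = s.coins := rfl
@[simp] lemma reg_setCoins : (s.setCoins l).reg = s.reg := rfl
@[simp] lemma arr_setCoins : (s.setCoins l).arr = s.arr := rfl
@[simp] lemma out_setCoins : (s.setCoins l).out = s.out := rfl
@[simp] lemma coins_setCoins : (s.setCoins l).coins = l := rfl

end

end RAMState

namespace RAMProgram

/-- Started in `s`, the program `p` halts within `t` steps in a state with the property `Q`. -/
def Ends (p : RAMProgram) (t : ℕ) (s : RAMState) (Q : RAMState → Prop) : Prop :=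
  ∃ t' ≤ t, ∃ s', p.Exec s t' s' ∧ Q s'

namespace Ends

variable {p q : RAMProgram} {s : RAMState} {t t' : ℕ} {Q Q' : RAMState → Prop}

lemma mono (h : Ends p t s Q) (ht : t ≤ t') (hQ : ∀ s, Q s → Q' s) : Ends p t' s Q' := by
  obtain ⟨u, hu, s', he, hq⟩ := h
  exact ⟨u, hu.trans ht, s', he, hQ s' hq⟩

lemma seq (h : Ends p t s fun s' => Ends q t' s' Q) : Ends (.seq p q) (t + t') s Q := by
  obtain ⟨u, hu, s', he, u', hu', s'', he', hq⟩ := h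
  exact ⟨u + u', by omega, s'', .seq he he', hq⟩

lemma assign {r : ℕ} {e : RAMExpr} (h : Q (s.setReg r (e.eval s))) :
    Ends (.assign r e) 1 s Q := ⟨1, le_rfl, _, .assign r e s, h⟩

lemma store {a : ℕ} {i e : RAMExpr} (h : Q (s.setArr a (i.eval s) (e.eval s))) :
    Ends (.store a i e) 1 s Q := ⟨1, le_rfl, _, .store a i e s, h⟩

lemma write {e : RAMExpr} (h : Q (s.emit (e.eval s))) : Ends (.write e) 1 s Q :=
  ⟨1, le_rfl, _, .write e s, h⟩

lemma skip (h : Q s) : Ends .skip 1 s Q := ⟨1, le_rfl, _, .skip s, h⟩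

lemma coin {r : ℕ} {b : Bool} {l : List Bool} (hs : s.coins = b :: l)
    (h : Q ((s.setReg r b.toNat).setCoins l)) : Ends (.coin r) 1 s Q :=
  ⟨1, le_rfl, _, .coin r b l s hs, h⟩

lemma ifLt {e f : RAMExpr} (hp : e.eval s < f.eval s → Ends p t s Q)
    (hq : ¬ e.eval s < f.eval s → Ends q t s Q) : Ends (.ifLt e f p q) (t + 1) s Q := by
  by_cases hc : e.eval s < f.eval s
  · obtain ⟨u, hu, s', he, hQ⟩ := hp hc
    exact ⟨u + 1, by omega, s', .if_true hc he, hQ⟩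
  · obtain ⟨u, hu, s', he, hQ⟩ := hq hc
    exact ⟨u + 1, by omega, s', .if_false hc he, hQ⟩

/-- A loop with invariant `I` that is executed for the counts from `k` to `N - 1`. -/
lemma whileLt {e f : RAMExpr} (I : ℕ → RAMState → Prop) (N : ℕ)
    (htest : ∀ k s, k ≤ N → I k s → (e.eval s < f.eval s ↔ k < N))
    (hbody : ∀ k s, k < N → I k s → Ends p t s (I (k + 1)))
    (h0 : I 0 s) : Ends (.whileLt e f p) (N * (t + 1) + 1) s (I N) := by
  have key : ∀ d k s, k + d = N → I k s →
      Ends (.whileLt e f p) (d * (t + 1) + 1) s (I N) := by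
    intro d
    induction d with
    | zero =>
      intro k s hk hI
      have hk' : k = N := by omega
      subst hk'
      exact ⟨1, by omega, s, .while_false (fun h => lt_irrefl k ((htest k s le_rfl hI).1 h)), hI⟩
    | succ d ih =>
      intro k s hk hI
      obtain ⟨u, hu, s', he, hI'⟩ := hbody k s (by omega) hI
      obtain ⟨u', hu', s'', he', hI''⟩ := ih (k + 1) s' (by omega) hI'
      refine ⟨u + u' + 1, ?_, s'', .while_true ((htest k s (by omega) hI).2 (by omega)) he he',
        hI''⟩
      rw [add_mul]
      omega
  exact key N 0 s (by omega) h0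

end Ends

/-- `p` if `e = f`, else `q`. -/
def ifEq (e f : RAMExpr) (p q : RAMProgram) : RAMProgram := .ifLt e f q (.ifLt f e q p)

lemma Ends.ifEq {p q : RAMProgram} {s : RAMState} {t : ℕ} {Q : RAMState → Prop} {e f : RAMExpr}
    (hp : e.eval s = f.eval s → Ends p t s Q) (hq : e.eval s ≠ f.eval s → Ends q t s Q) :
    Ends (ifEq e f p q) (t + 2) s Q := by
  refine Ends.ifLt (t := t + 1)
    (fun h => (hq (by omega)).mono (Nat.le_succ t) fun _ h => h) fun h => ?_
  exact Ends.ifLt (fun h' => hq (by omega)) fun h' => hp (by omega)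

/-- Run `p` for the values of register `r` from `0` to `e - 1`. -/
def forLoop (r : ℕ) (e : RAMExpr) (p : RAMProgram) : RAMProgram :=
  .seq (.assign r (.const 0))
    (.whileLt (.reg r) e (.seq p (.assign r (.add (.reg r) (.const 1)))))

/-- Each pass costs the body, the test and the increment; the final `2` pays for the initial
assignment and the failing test. -/
lemma Ends.forLoop {r : ℕ} {e : RAMExpr} {p : RAMProgram} {s : RAMState} {t : ℕ}
    (I : ℕ → RAMState → Prop) (N : ℕ)
    (htest : ∀ k s, I k s → s.reg r = k ∧ e.eval s = N)
    (hbody : ∀ k s, k < N → I k s → Ends p t s fun s' => I (k + 1) (s'.setReg r (s'.reg r + 1)))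
    (h0 : I 0 (s.setReg r 0)) : Ends (forLoop r e p) (N * (t + 2) + 2) s (I N) := by
  refine (Ends.seq (t := 1) (t' := N * (t + 1 + 1) + 1) ?_).mono
    (by rw [add_assoc t]; omega) fun _ h => h
  apply Ends.assign
  apply Ends.whileLt I N
  · intro k s _ hI
    simp [RAMExpr.eval, htest k s hI]
  · intro k s hk hI
    apply Ends.seq
    refine (hbody k s hk hI).mono le_rfl fun s' h => ?_
    exact Ends.assign h
  · exact h0

end RAMProgram

lemma List.take_finRange_succ {n k : ℕ} (hk : k < n) :
    (List.finRange n).take (k + 1) = (List.finRange n).take k ++ [⟨k, hk⟩] := by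
  rw [List.take_succ_eq_append_getElem (by simpa using hk)]
  simp

namespace CNOTCircuit

lemma encode_append {n : ℕ} (C D : CNOTCircuit (Fin n)) :
    CNOTCircuit.encode (C ++ D) = C.encode ++ D.encode := by
  simp [CNOTCircuit.encode]

lemma encode_gate {n : ℕ} (a b : Fin n) :
    (gate a b).encode = if a = b then [] else [(a : ℕ), (b : ℕ)] := by
  by_cases h : a = b <;> simp [gate, h, CNOTCircuit.encode]

end CNOTCircuit

/-! ### The program and its agreement with the sweep -/

namespace Sweep

open RAMProgram CNOTCircuit

/-- Vertices as numbers, `0` being no vertex. -/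
def code {n : ℕ} (o : Option (Fin n)) : ℕ := o.elim 0 fun v => (v : ℕ) + 1

lemma code_injective {n : ℕ} : Function.Injective (code (n := n)) := by
  intro a b h
  rcases a with _ | a <;> rcases b with _ | b
  · rfl
  · simp [code] at h
  · simp [code] at h
  · simp only [code, Option.elim_some] at h
    exact congrArg some (Fin.ext (by omega))

/-- The test whether the vertex in register 5 is a guest of the vertex in register 2. -/
def guestTest (p q : RAMProgram) : RAMProgram :=
  -- A sum of naturals is below `1` iff every summand vanishes: adjacency, not done, and equality of
  -- codes as two truncated differences.
  .ifLt (.add (.add (.sub (.const 1) (.entry 0 (.add (.reg 3) (.reg 5)))) (.entry 3 (.reg 5)))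
    (.add (.sub (.entry 2 (.reg 5)) (.reg 7)) (.sub (.reg 7) (.entry 2 (.reg 5))))) (.const 1) p q

/-- Write the gate from register 4 to register 2 if registers 6 and 7 are positive. -/
def visitProgram : RAMProgram :=
  .ifLt (.const 0) (.reg 6)
    (.ifLt (.const 0) (.reg 7) (.seq (.write (.reg 4)) (.write (.reg 2))) .skip) .skip

/-- Write the circuit `round`. -/
def roundProgram : RAMProgram :=
  .seq (ifEq (.reg 4) (.reg 2) (.assign 7 (.const 0)) (.assign 7 (.add (.reg 4) (.const 1))))
  (.seq (.assign 6 (.const 0))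
  (.seq (forLoop 5 (.reg 0) (guestTest (.assign 6 (.const 1)) .skip))
  (.seq visitProgram
  (.seq (forLoop 5 (.reg 0) (guestTest (.seq (.write (.reg 2)) (.write (.reg 5))) .skip))
  visitProgram))))

/-- Carry out `settle`. -/
def settleProgram : RAMProgram :=
  .seq (.ifLt (.const 0) (.entry 2 (.reg 2))
    (.seq (.write (.sub (.entry 2 (.reg 2)) (.const 1))) (.write (.reg 2))) .skip)
  (.store 3 (.reg 2) (.const 1))

/-- Carry out `treat`. -/
def treatProgram : RAMProgram :=
  .seq settleProgram
  (.seq (forLoop 4 (.reg 0) roundProgram)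
  (forLoop 5 (.reg 0)
    (.ifLt (.const 0) (.entry 0 (.add (.reg 3) (.reg 5)))
      (.store 2 (.reg 5) (.add (.reg 2) (.const 1))) .skip)))

/-- Treat all vertices in their order. -/
def sweepProgram : RAMProgram :=
  forLoop 1 (.add (.reg 0) (.reg 0))
    (.seq (.assign 3 (.const 0))
      (forLoop 2 (.reg 0)
        (.seq (ifEq (.entry 1 (.reg 2)) (.reg 1) treatProgram .skip)
          (.assign 3 (.add (.reg 3) (.reg 0))))))

/-- Toss the coins for the labels. -/
def labelProgram : RAMProgram :=
  forLoop 2 (.reg 0)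
    (.seq (.assign 9 (.const 1))
      (.whileLt (.reg 9) (.reg 0)
        (.seq (.coin 8)
        (.seq (.ifLt (.const 0) (.reg 8)
          (.store 1 (.reg 2) (.add (.entry 1 (.reg 2)) (.reg 9))) .skip)
        (.assign 9 (.add (.reg 9) (.reg 9)))))))

/-- The randomized algorithm. -/
def networkProgram : RAMProgram := .seq labelProgram sweepProgram

variable {n : ℕ} (G : SimpleGraph (Fin n)) [DecidableRel G.Adj] (label : Fin n → ℕ)

/-- The state `s` of the machine represents the graph, the labels and the state `S` of the
sweep. -/
structure Rep (S : Sweep n) (s : RAMState) : Prop where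
  size : s.reg 0 = n
  adj : ∀ v w : Fin n, s.arr 0 (v * n + w) = if G.Adj v w then 1 else 0
  label : ∀ v : Fin n, s.arr 1 v = label v
  last : ∀ v : Fin n, s.arr 2 v = code (S.last v)
  done : ∀ v : Fin n, s.arr 3 v = (S.done v).toNat
  ne : ∀ v : Fin n, S.last v ≠ some v
  out : s.out = S.circuit.encode

variable {G label}

lemma Rep.setReg {S : Sweep n} {s : RAMState} (h : Rep G label S s) {r : ℕ} (hr : r ≠ 0) (x : ℕ) :
    Rep G label S (s.setReg r x) :=
  ⟨by simp [hr.symm, h.size], h.adj, h.label, h.last, h.done, h.ne, h.out⟩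

/-- Register `2` holds `v`, and register `3` the start of its row in the adjacency matrix. -/
structure AtVertex (b : ℕ) (v : Fin n) (s : RAMState) : Prop where
  block : s.reg 1 = b
  vertex : s.reg 2 = v
  row : s.reg 3 = v * n

lemma AtVertex.setReg {b : ℕ} {v : Fin n} {s : RAMState} (h : AtVertex b v s) {r : ℕ}
    (hr : 3 < r) (x : ℕ) : AtVertex b v (s.setReg r x) := by
  constructor
  · rw [RAMState.reg_setReg, if_neg (by omega), h.block]
  · rw [RAMState.reg_setReg, if_neg (by omega), h.vertex]
  · rw [RAMState.reg_setReg, if_neg (by omega), h.row]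

lemma ends_guestTest {S : Sweep n} {s : RAMState} {b t : ℕ} {v w : Fin n} {o : Option (Fin n)}
    {p q : RAMProgram} {Q : RAMState → Prop} (h : Rep G label S s) (hv : AtVertex b v s)
    (hw : s.reg 5 = w) (ho : s.reg 7 = code o)
    (hp : w ∈ S.guests G v o → Ends p t s Q) (hq : w ∉ S.guests G v o → Ends q t s Q) :
    Ends (guestTest p q) (t + 1) s Q := by
  have hc : (1 - s.arr 0 (v * n + w) + s.arr 3 w + (s.arr 2 w - s.reg 7 + (s.reg 7 - s.arr 2 w))
      < 1) ↔ w ∈ S.guests G v o := by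
    rw [mem_guests, h.adj, h.last, h.done, ho, ← code_injective.eq_iff]
    by_cases h1 : G.Adj v w
    · cases h2 : S.done w
      · simp only [h1, if_true, Bool.toNat_false]
        simp only [true_and]
        omega
      · simp
    · simp [h1]
  refine Ends.ifLt (fun h => hp ?_) fun h => hq ?_
  · simpa only [RAMExpr.eval, hv.row, hw, hc] using h
  · simpa only [RAMExpr.eval, hv.row, hw, hc] using h

lemma Rep.visit {S : Sweep n} {s : RAMState} {b : ℕ} {v i : Fin n} {Q : RAMState → Prop}
    {c : Prop} [Decidable c] (h : Rep G label S s) (hv : AtVertex b v s) (hi : s.reg 4 = i)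
    (h6 : 0 < s.reg 6 ↔ ¬ c) (h7 : s.reg 7 = code (key v i))
    (hQ : ∀ s', Rep G label { S with circuit := S.circuit ++ if c then [] else gate i v } s' →
      s'.reg = s.reg → Q s') : Ends visitProgram 4 s Q := by
  have hskip : (c ∨ i = v) → Q s := by
    intro hc
    refine hQ s ⟨h.size, h.adj, h.label, h.last, h.done, h.ne, ?_⟩ rfl
    rw [h.out]
    rcases hc with hc | rfl
    · simp [hc]
    · simp [gate_self]
  refine Ends.ifLt (t := 3) (fun hc => ?_) fun hc => ?_
  · have hc := h6.1 hc
    refine Ends.ifLt (t := 2) (fun hk => ?_) fun hk => ?_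
    · apply Ends.seq (t := 1) (t' := 1)
      apply Ends.write
      apply Ends.write
      have hiv : i ≠ v := by rintro rfl; simp [RAMExpr.eval, h7, key, code] at hk
      refine hQ _ ⟨h.size, h.adj, h.label, h.last, h.done, h.ne, ?_⟩ rfl
      simp [RAMExpr.eval, h.out, hc, encode_append, encode_gate, hiv, hi, hv.vertex]
    · refine (Ends.skip (hskip (Or.inr ?_))).mono (by omega) fun _ h => h
      by_contra hiv
      simp [RAMExpr.eval, h7, key, hiv, code] at hk
  · exact (Ends.skip (hskip (Or.inl (not_not.1 (mt h6.2 hc))))).mono (by omega) fun _ h => h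

/-- The time for `roundProgram`. -/
def roundTime (n : ℕ) : ℕ := 3 + (1 + ((n * 4 + 2) + (4 + ((n * 5 + 2) + 4))))

lemma Rep.round {S : Sweep n} {s : RAMState} {b : ℕ} {v i : Fin n}
    (h : Rep G label S s) (hv : AtVertex b v s) (hi : s.reg 4 = i) :
    Ends roundProgram (roundTime n) s fun s' =>
      Rep G label { S with circuit := S.circuit ++ S.round G v i } s' ∧ AtVertex b v s' ∧
        s'.reg 4 = i := by
  have h1 : Ends (ifEq (.reg 4) (.reg 2) (.assign 7 (.const 0))
      (.assign 7 (.add (.reg 4) (.const 1)))) 3 s fun s' => s' = s.setReg 7 (code (key v i)) := by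
    refine Ends.ifEq (t := 1) (fun hiv => ?_) fun hiv => ?_ <;>
      simp only [RAMExpr.eval, hi, hv.vertex, ne_eq, Fin.val_inj] at hiv
    · apply Ends.assign; simp [key, hiv, code, RAMExpr.eval]
    · apply Ends.assign; simp [key, hiv, code, RAMExpr.eval, hi]
  apply Ends.seq
  refine h1.mono le_rfl fun s' hs' => ?_
  subst hs'
  apply Ends.seq
  apply Ends.assign
  -- the flag
  apply Ends.seq
  refine (Ends.forLoop (t := 2) (fun k s => Rep G label S s ∧ AtVertex b v s ∧ s.reg 4 = i ∧
    s.reg 7 = code (key v i) ∧ s.reg 5 = k ∧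
    (0 < s.reg 6 ↔ ∃ w ∈ S.guests G v (key v i), (w : ℕ) < k)) n ?_ ?_ ?_).mono le_rfl ?_
  · rintro k s ⟨h, -, -, -, h5, -⟩
    exact ⟨h5, h.size⟩
  · rintro k s hk ⟨h, hv, h4, h7, h5, h6⟩
    refine ends_guestTest (t := 1) (w := ⟨k, hk⟩) h hv h5 h7 (fun hg => ?_) fun hg => ?_
    · apply Ends.assign
      refine ⟨(h.setReg (by norm_num) _).setReg (by norm_num) _,
        (hv.setReg (by norm_num) _).setReg (by norm_num) _, by simp [h4], by simp [h7],
        by simp [h5], ?_⟩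
      rw [RAMState.reg_setReg, if_neg (by norm_num), RAMState.reg_setReg, if_pos rfl]
      exact ⟨fun _ => ⟨_, hg, Nat.lt_succ_self k⟩, fun _ => Nat.one_pos⟩
    · apply Ends.skip
      refine ⟨h.setReg (by norm_num) _, hv.setReg (by norm_num) _, by simp [h4], by simp [h7],
        by simp [h5], ?_⟩
      rw [RAMState.reg_setReg, if_neg (by norm_num), h6]
      refine exists_congr fun w => and_congr_right fun hw => ?_
      have : (w : ℕ) ≠ k := by rintro rfl; exact hg hw
      omega
  · refine ⟨((h.setReg (by norm_num) _).setReg (by norm_num) _).setReg (by norm_num) _,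
      ((hv.setReg (by norm_num) _).setReg (by norm_num) _).setReg (by norm_num) _,
      by simp [hi], by simp, by simp, by simp [RAMExpr.eval]⟩
  clear h hv hi h1 s
  rintro s ⟨h, hv, hi, h7, -, h6⟩
  replace h6 : 0 < s.reg 6 ↔ ¬ S.guests G v (key v i) = [] := by
    rw [h6, List.eq_nil_iff_forall_not_mem, not_forall_not]
    exact exists_congr fun w => and_iff_left w.2
  -- the first visit
  apply Ends.seq
  refine h.visit hv hi h6 h7 fun s' h' hs' => ?_
  replace hv : AtVertex b v s' := ⟨hs' ▸ hv.block, hs' ▸ hv.vertex, hs' ▸ hv.row⟩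
  rw [← hs'] at hi h6 h7
  clear h hs' s
  -- the guests
  apply Ends.seq
  refine (Ends.forLoop (t := 3) (fun k s => Rep G label { S with circuit := S.circuit ++
      (if S.guests G v (key v i) = [] then [] else gate i v) ++
      (((List.finRange n).take k).filter (· ∈ S.guests G v (key v i))).flatMap (gate v) } s ∧
    AtVertex b v s ∧ s.reg 4 = i ∧
    s.reg 7 = code (key v i) ∧ s.reg 5 = k ∧
    (0 < s.reg 6 ↔ ¬ S.guests G v (key v i) = [])) n ?_ ?_ ?_).mono le_rfl ?_
  · rintro k s ⟨h, -, -, -, h5, -⟩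
    exact ⟨h5, h.size⟩
  · rintro k s hk ⟨h, hv, h4, h7, h5, h6⟩
    refine ends_guestTest (t := 2) (w := ⟨k, hk⟩) h hv h5 h7 (fun hg => ?_) fun hg => ?_
    · change _ ∈ S.guests G v (key v i) at hg
      apply Ends.seq (t := 1) (t' := 1)
      apply Ends.write
      apply Ends.write
      refine ⟨⟨?_, h.adj, h.label, h.last, h.done, h.ne, ?_⟩, ?_, by simp [h4], by simp [h7],
        by simp [h5], by simpa using h6⟩
      · simp [h.size]
      · have hne : v ≠ ⟨k, hk⟩ := ((mem_guests G).1 hg).1.ne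
        simp [RAMExpr.eval, h.out, List.take_finRange_succ hk, List.filter_append, hg,
          encode_append, encode_gate, hne, hv.vertex, h5]
      · refine AtVertex.setReg ?_ (by norm_num) _
        exact ⟨hv.block, hv.vertex, hv.row⟩
    · change _ ∉ S.guests G v (key v i) at hg
      refine (Ends.skip ?_).mono (by omega) fun _ h => h
      refine ⟨?_, hv.setReg (by norm_num) _, by simp [h4], by simp [h7],
        by simp [h5], by simpa using h6⟩
      rw [List.take_finRange_succ hk, List.filter_append]
      simpa [hg] using h.setReg (by norm_num) _
  · exact ⟨by simpa using h'.setReg (by norm_num) _, hv.setReg (by norm_num) _, by simp [hi],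
      by simp [h7], by simp, by simpa using h6⟩
  clear h' hv hi h7 h6 s'
  rintro s ⟨h, hv, hi, h7, -, h6⟩
  -- the second visit
  refine h.visit hv hi h6 h7 fun s' h' hs' => ?_
  refine ⟨?_, ⟨hs' ▸ hv.block, hs' ▸ hv.vertex, hs' ▸ hv.row⟩, hs' ▸ hi⟩
  have hfil : (((List.finRange n).take n).filter fun w => w ∈ S.guests G v (key v i)) =
      S.guests G v (key v i) := by
    rw [List.take_of_length_le (by simp), guests]
    refine List.filter_congr fun w _ => ?_
    simp [List.mem_filter]
  rw [hfil] at h'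
  simpa only [Sweep.round, List.append_assoc] using h'

lemma Rep.settle {S : Sweep n} {s : RAMState} {b : ℕ} {v : Fin n}
    (h : Rep G label S s) (hv : AtVertex b v s) :
    Ends settleProgram 4 s fun s' => Rep G label (S.settle v) s' ∧ AtVertex b v s' := by
  have h1 : Ends (.ifLt (.const 0) (.entry 2 (.reg 2))
      (.seq (.write (.sub (.entry 2 (.reg 2)) (.const 1))) (.write (.reg 2))) .skip) 3 s fun s' =>
      s'.reg = s.reg ∧ s'.arr = s.arr ∧ s'.out = (S.settle v).circuit.encode := by
    have hl := h.last v
    refine Ends.ifLt (t := 2) (fun hc => ?_) fun hc => ?_ <;>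
      simp only [RAMExpr.eval, hv.vertex] at hc
    · apply Ends.seq (t := 1) (t' := 1)
      apply Ends.write
      apply Ends.write
      refine ⟨rfl, rfl, ?_⟩
      rcases ho : S.last v with _ | u
      · rw [hl, ho] at hc; simp [code] at hc
      · have hu : u ≠ v := by rintro rfl; exact h.ne u ho
        rw [ho] at hl
        simp [RAMExpr.eval, Sweep.settle, ho, encode_append, encode_gate, hu, h.out, hv.vertex,
          hl, code]
    · refine (Ends.skip ⟨rfl, rfl, ?_⟩).mono (by omega) fun _ h => h
      rcases ho : S.last v with _ | u
      · simp [Sweep.settle, ho, h.out]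
      · rw [hl, ho] at hc; simp [code] at hc
  apply Ends.seq (t := 3) (t' := 1)
  refine h1.mono le_rfl fun s' ⟨hr, ha, ho⟩ => ?_
  apply Ends.store
  refine ⟨⟨by simp [hr, h.size], ?_, ?_, ?_, ?_, h.ne, ho⟩, ⟨by simp [hr, hv.block],
    by simp [hr, hv.vertex], by simp [hr, hv.row]⟩⟩
  · intro a c; simp [ha, h.adj]
  · intro a; simp [ha, h.label]
  · intro a; simp [ha, h.last, Sweep.settle]
  · intro a
    by_cases hav : a = v
    · subst hav; simp [RAMExpr.eval, hr, hv.vertex, Sweep.settle]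
    · simp [RAMExpr.eval, hr, hv.vertex, Sweep.settle, Fin.val_inj, hav, ha, h.done]

/-- The time for `treatProgram`. -/
def treatTime (n : ℕ) : ℕ := 4 + ((n * (roundTime n + 2) + 2) + (n * 4 + 2))

lemma Rep.treat {S : Sweep n} {s : RAMState} {b : ℕ} {v : Fin n}
    (h : Rep G label S s) (hv : AtVertex b v s) :
    Ends treatProgram (treatTime n) s fun s' =>
      Rep G label (S.treat G v) s' ∧ AtVertex b v s' := by
  apply Ends.seq
  refine (h.settle hv).mono le_rfl ?_
  clear h hv s
  rintro s ⟨h, hv⟩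
  apply Ends.seq
  refine (Ends.forLoop (t := roundTime n) (fun k s => Rep G label { S.settle v with
    circuit := (S.settle v).circuit ++ ((List.finRange n).take k).flatMap
      ((S.settle v).round G v) } s ∧ AtVertex b v s ∧ s.reg 4 = k) n ?_ ?_ ?_).mono le_rfl ?_
  · rintro k s ⟨h, -, h4⟩
    exact ⟨h4, h.size⟩
  · rintro k s hk ⟨h, hv, h4⟩
    refine (h.round hv (i := ⟨k, hk⟩) h4).mono le_rfl ?_
    rintro s ⟨h, hv, h4⟩
    refine ⟨?_, hv.setReg (by norm_num) _, by simp [h4]⟩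
    rw [List.take_finRange_succ hk, List.flatMap_append]
    -- A round depends only on `last` and `done`, not on the circuit written so far.
    simpa [Sweep.round, guests] using h.setReg (by norm_num) _
  · exact ⟨by simpa using h.setReg (by norm_num) _, hv.setReg (by norm_num) _, by simp⟩
  clear h hv s
  rintro s ⟨h, hv, -⟩
  rw [List.take_of_length_le (by simp)] at h
  refine (Ends.forLoop (t := 2) (fun k s => Rep G label
    ⟨fun w => if (w : ℕ) < k ∧ G.Adj v w then some v else S.last w, (S.settle v).done,
      (S.treat G v).circuit⟩ s ∧ AtVertex b v s ∧ s.reg 5 = k) n ?_ ?_ ?_).mono le_rfl ?_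
  · rintro k s ⟨h, -, h5⟩
    exact ⟨h5, h.size⟩
  · rintro k s hk ⟨h, hv, h5⟩
    have hadj := h.adj v ⟨k, hk⟩
    simp only at hadj
    refine Ends.ifLt (t := 1) (fun hc => ?_) fun hc => ?_ <;>
      simp only [RAMExpr.eval, hv.row, h5, hadj] at hc
    · have hc : G.Adj v ⟨k, hk⟩ := by by_contra h'; simp [h'] at hc
      apply Ends.store
      refine ⟨⟨by simp [h.size], fun a c => by simp [h.adj], fun a => by simp [h.label], ?_,
        fun a => by simp [h.done], ?_, h.out⟩, ?_, by simp [h5]⟩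
      · intro a
        by_cases ha : (a : ℕ) = k
        · have : a = ⟨k, hk⟩ := Fin.ext ha
          subst this
          simp [RAMExpr.eval, h5, hv.vertex, hc, code]
        · have hlt : (a : ℕ) < k + 1 ↔ (a : ℕ) < k := by omega
          simp [RAMExpr.eval, h5, ha, h.last, hlt]
      · intro a
        by_cases ha : (a : ℕ) = k
        · have : a = ⟨k, hk⟩ := Fin.ext ha
          subst this
          simp [hc, hc.ne]
        · have hlt : (a : ℕ) < k + 1 ↔ (a : ℕ) < k := by omega
          have := h.ne a
          simpa only [hlt] using this
      · refine AtVertex.setReg ?_ (by norm_num) _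
        exact ⟨hv.block, hv.vertex, hv.row⟩
    · have hc : ¬ G.Adj v ⟨k, hk⟩ := by by_contra h'; simp [h'] at hc
      apply Ends.skip
      refine ⟨?_, hv.setReg (by norm_num) _, by simp [h5]⟩
      have : (fun w : Fin n => if (w : ℕ) < k + 1 ∧ G.Adj v w then some v else S.last w) =
          fun w : Fin n => if (w : ℕ) < k ∧ G.Adj v w then some v else S.last w := by
        funext a
        by_cases ha : (a : ℕ) = k
        · have : a = ⟨k, hk⟩ := Fin.ext ha
          subst this
          simp [hc]
        · have hlt : (a : ℕ) < k + 1 ↔ (a : ℕ) < k := by omega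
          simp only [hlt]
      rw [this]
      exact h.setReg (by norm_num) _
  · refine ⟨?_, hv.setReg (by norm_num) _, by simp⟩
    simpa [Sweep.treat, Sweep.settle] using h.setReg (r := 5) (by norm_num) 0
  · rintro s ⟨h, hv, -⟩
    refine ⟨?_, hv⟩
    simpa [Sweep.treat] using h

/-- The time for `sweepProgram`. -/
def sweepTime (n : ℕ) : ℕ :=
  (n + n) * ((1 + (n * (((treatTime n + 2) + 1) + 2) + 2)) + 2) + 2

/-- The nested loops over labels and vertices enumerate `order label`, so no sorting is needed; the
row offset grows by `n` per vertex, which avoids multiplication. -/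
lemma Rep.sweep {S : Sweep n} {s : RAMState} (h : Rep G label S s) :
    Ends sweepProgram (sweepTime n) s
      (Rep G label ((order label).foldl (Sweep.treat G) S)) := by
  refine (Ends.forLoop (fun k s => Rep G label
    ((((List.finRange (n + n)).take k).flatMap fun b : Fin (n + n) =>
      (List.finRange n).filter fun v => label v = (b : ℕ)).foldl (Sweep.treat G) S) s ∧
        s.reg 1 = k) (n + n) ?_ ?_ ?_).mono le_rfl ?_
  · rintro k s ⟨h, h1⟩
    exact ⟨h1, by simp [RAMExpr.eval, h.size]⟩
  · clear h s
    rintro k s hk ⟨h, h1⟩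
    rw [List.take_finRange_succ hk, List.flatMap_append, List.foldl_append]
    generalize List.foldl (Sweep.treat G) S (List.flatMap _ _) = S at h ⊢
    simp only [List.flatMap_cons, List.flatMap_nil, List.append_nil]
    apply Ends.seq
    apply Ends.assign
    refine (Ends.forLoop (t := treatTime n + 2 + 1) (fun j s => Rep G label
      ((((List.finRange n).take j).filter fun v => label v = k).foldl (Sweep.treat G) S) s ∧
        s.reg 1 = k ∧ s.reg 2 = j ∧ s.reg 3 = j * n) n ?_ ?_ ?_).mono le_rfl ?_
    · rintro j s ⟨h, -, h2, -⟩
      exact ⟨h2, h.size⟩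
    · clear h h1 s
      rintro j s hj ⟨h, h1, h2, h3⟩
      rw [List.take_finRange_succ hj, List.filter_append, List.foldl_append]
      generalize List.foldl (Sweep.treat G) S (List.filter _ _) = S at h ⊢
      have hv : AtVertex k ⟨j, hj⟩ s := ⟨h1, h2, h3⟩
      have hlabel := h.label ⟨j, hj⟩
      have hend : Ends (ifEq (.entry 1 (.reg 2)) (.reg 1) treatProgram .skip) (treatTime n + 2) s
          fun s => Rep G label ((([⟨j, hj⟩] : List (Fin n)).filter fun v => label v = k).foldl
            (Sweep.treat G) S) s ∧ AtVertex k ⟨j, hj⟩ s := by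
        refine Ends.ifEq (fun hc => ?_) fun hc => ?_ <;>
          simp only [RAMExpr.eval, h2, h1, ne_eq] at hc
        · rw [hlabel] at hc
          simpa [hc] using h.treat hv
        · rw [hlabel] at hc
          refine (Ends.skip (Q := fun s => _) ⟨?_, hv⟩).mono ?_ fun _ h => h
          · unfold treatTime; omega
          · simpa [hc] using h
      apply Ends.seq
      refine hend.mono le_rfl ?_
      clear h h1 h2 h3 hend hlabel hv s
      rintro s ⟨h, hv⟩
      apply Ends.assign
      refine ⟨(h.setReg (by norm_num) _).setReg (by norm_num) _, by simp [hv.block],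
        by simp [hv.vertex], ?_⟩
      simp [RAMExpr.eval, hv.row, h.size, add_mul]
    · exact ⟨by simpa [RAMExpr.eval] using (h.setReg (r := 3) (by norm_num) 0).setReg (r := 2) (by norm_num) 0,
        by simp [h1], by simp, by simp [RAMExpr.eval]⟩
    · rintro s ⟨h, h1, -⟩
      rw [List.take_of_length_le (by simp)] at h
      exact ⟨h.setReg (by norm_num) _, by simp [h1]⟩
  · exact ⟨by simpa using h.setReg (r := 1) (by norm_num) 0, by simp⟩
  · rintro s ⟨h, -⟩
    rwa [List.take_of_length_le (by simp)] at h

end Sweep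

/-! ### Tossing the labels, and the total running time -/

namespace Sweep

open RAMProgram CNOTCircuit

/-- The `m`-th coin as a number. -/
def coinValue {R : ℕ} (ω : Fin R → Bool) (m : ℕ) : ℕ :=
  if h : m < R then (ω ⟨m, h⟩).toNat else 0

/-- The state after the labels of the vertices below `k` and the first `l` bits of the label of
`k` were determined. -/
structure Tossing {R n : ℕ} (G : SimpleGraph (Fin n)) [DecidableRel G.Adj] (ω : Fin R → Bool)
    (k l : ℕ) (s : RAMState) : Prop where
  size : s.reg 0 = n
  vertex : s.reg 2 = k
  adj : s.arr 0 = (RAMState.init G (List.ofFn ω)).arr 0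
  label : ∀ v, s.arr 1 v = if v < k then
    ∑ l ∈ Finset.range (Nat.clog 2 n), coinValue ω (v * Nat.clog 2 n + l) * 2 ^ l
    else if v = k then ∑ l ∈ Finset.range l, coinValue ω (v * Nat.clog 2 n + l) * 2 ^ l
    else 0
  last : ∀ v, s.arr 2 v = 0
  done : ∀ v, s.arr 3 v = 0
  out : s.out = []
  coins : s.coins = (List.ofFn ω).drop (k * Nat.clog 2 n + l)

/-- The time for `labelProgram`. -/
def labelTime (n : ℕ) : ℕ := n * ((1 + (n * ((1 + (2 + 1)) + 1) + 1)) + 2) + 2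

variable {R n : ℕ} {G : SimpleGraph (Fin n)} [DecidableRel G.Adj] {ω : Fin R → Bool}

lemma Tossing.toss {k l : ℕ} {s : RAMState} (h : Tossing G ω k l s)
    (hm : k * Nat.clog 2 n + l < R) (h9 : s.reg 9 = 2 ^ l) :
    Ends (.seq (.coin 8)
        (.seq (.ifLt (.const 0) (.reg 8)
          (.store 1 (.reg 2) (.add (.entry 1 (.reg 2)) (.reg 9))) .skip)
        (.assign 9 (.add (.reg 9) (.reg 9))))) (1 + (2 + 1)) s
      fun s => Tossing G ω k (l + 1) s ∧ s.reg 9 = 2 ^ (l + 1) := by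
  set m := k * Nat.clog 2 n + l with hmdef
  have hcoins : s.coins = ω ⟨m, hm⟩ :: (List.ofFn ω).drop (m + 1) := by
    rw [h.coins, List.drop_eq_getElem_cons (by simpa using hm)]
    simp [hmdef]
  apply Ends.seq
  refine Ends.coin hcoins ?_
  set s₁ := (s.setReg 8 (ω ⟨m, hm⟩).toNat).setCoins ((List.ofFn ω).drop (m + 1)) with hs₁
  have h1 : Ends (.ifLt (.const 0) (.reg 8)
      (.store 1 (.reg 2) (.add (.entry 1 (.reg 2)) (.reg 9))) .skip) 2 s₁ fun s' =>
      Tossing G ω k (l + 1) s' ∧ s'.reg 9 = 2 ^ l := by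
    have hval : coinValue ω m = (ω ⟨m, hm⟩).toNat := by simp [coinValue, hm]
    have hlabel : ∀ v, (if v < k then
        ∑ l ∈ Finset.range (Nat.clog 2 n), coinValue ω (v * Nat.clog 2 n + l) * 2 ^ l
        else if v = k then
          ∑ l ∈ Finset.range (l + 1), coinValue ω (v * Nat.clog 2 n + l) * 2 ^ l
        else 0) = s.arr 1 v + if v = k then (ω ⟨m, hm⟩).toNat * 2 ^ l else 0 := by
      intro v
      rw [h.label]
      by_cases hv : v = k
      · subst hv
        simp only [lt_irrefl, if_false, if_true]
        rw [Finset.sum_range_succ, ← hmdef, hval]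
      · simp [hv]
    refine Ends.ifLt (t := 1) (fun hc => ?_) fun hc => ?_ <;>
      simp only [RAMExpr.eval, hs₁, RAMState.reg_setCoins, RAMState.reg_setReg, if_true] at hc
    · have hb : (ω ⟨m, hm⟩).toNat = 1 := by
        have := Bool.toNat_le (ω ⟨m, hm⟩); omega
      apply Ends.store
      refine ⟨⟨by simp [hs₁, h.size], by simp [hs₁, h.vertex], ?_, ?_, by simp [hs₁, h.last],
        by simp [hs₁, h.done], by simp [hs₁, h.out], by simp [hs₁, hmdef, add_assoc]⟩,
        by simp [hs₁, h9]⟩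
      · funext a; simp [hs₁, h.adj]
      · intro v
        rw [hlabel, hb]
        by_cases hv : v = k
        · simp [hs₁, hv, RAMExpr.eval, h.vertex, h9]
        · simp [hs₁, hv, RAMExpr.eval, h.vertex]
    · have hb : (ω ⟨m, hm⟩).toNat = 0 := by omega
      apply Ends.skip
      refine ⟨⟨by simp [hs₁, h.size], by simp [hs₁, h.vertex], by simp [hs₁, h.adj], ?_,
        by simp [hs₁, h.last],
        by simp [hs₁, h.done], by simp [hs₁, h.out], by simp [hs₁, hmdef, add_assoc]⟩,
        by simp [hs₁, h9]⟩
      intro v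
      rw [hlabel, hb]
      simp [hs₁]
  apply Ends.seq
  refine h1.mono le_rfl ?_
  rintro s' ⟨h', h9'⟩
  apply Ends.assign
  refine ⟨⟨by simp [h'.size], by simp [h'.vertex], h'.adj, h'.label, h'.last, h'.done, h'.out,
    h'.coins⟩, ?_⟩
  simp [RAMExpr.eval, h9', pow_succ, mul_two]

lemma ends_labelProgram (hR : n * Nat.clog 2 n ≤ R) :
    Ends labelProgram (labelTime n) (RAMState.init G (List.ofFn ω)) (Tossing G ω n 0) := by
  have hclog : Nat.clog 2 n ≤ n := (Nat.clog_le_iff_le_pow (by norm_num)).2 Nat.lt_two_pow_self.le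
  refine (Ends.forLoop (t := 1 + (n * ((1 + (2 + 1)) + 1) + 1)) (Tossing G ω · 0) n ?_ ?_ ?_).mono
    le_rfl fun _ h => h
  · exact fun k s h => ⟨h.vertex, h.size⟩
  · intro k s hk h
    apply Ends.seq
    apply Ends.assign
    refine (Ends.whileLt (t := 1 + (2 + 1)) (fun l s => Tossing G ω k l s ∧ s.reg 9 = 2 ^ l)
      (Nat.clog 2 n) ?_ ?_ ?_).mono (by gcongr) ?_
    · rintro l s - ⟨h, h9⟩
      simp only [RAMExpr.eval, h9, h.size]
      -- Doubling register 9 until it reaches `n` takes exactly `Nat.clog 2 n` tosses, without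
      -- computing the logarithm.
      rw [← not_le, ← not_le, Nat.clog_le_iff_le_pow (by norm_num)]
    · rintro l s hl ⟨h, h9⟩
      refine h.toss ?_ h9
      have h1 : (k + 1) * Nat.clog 2 n ≤ n * Nat.clog 2 n := Nat.mul_le_mul_right _ hk
      rw [add_mul] at h1
      omega
    · refine ⟨⟨by simp [h.size], by simp [h.vertex], h.adj, h.label, h.last, h.done, h.out,
        h.coins⟩, by simp [RAMExpr.eval]⟩
    · rintro s ⟨h, -⟩
      refine ⟨by simp [h.size], by simp [h.vertex], h.adj, ?_, h.last, h.done, h.out, ?_⟩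
      · intro v
        rw [RAMState.arr_setReg, h.label]
        rcases lt_trichotomy v k with hv | hv | hv
        · simp [hv, hv.trans (Nat.lt_succ_self k)]
        · simp [hv]
        · have h1 : ¬ v < k := by omega
          have h2 : ¬ v < k + 1 := by omega
          simp [h1, h2, hv.ne']
      · rw [RAMState.coins_setReg, h.coins, add_mul, one_mul, add_zero]
  · refine ⟨by simp [RAMState.init], by simp, rfl, ?_, ?_, ?_, rfl, by simp [RAMState.init]⟩
    · intro v; simp [RAMState.init]
    · intro v; simp [RAMState.init]
    · intro v; simp [RAMState.init]

lemma Tossing.rep {s : RAMState} (h : Tossing G ω n 0 s) :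
    Rep G (coinLabel n (Nat.clog 2 n) ω) (start n) s := by
  refine ⟨h.size, ?_, ?_, fun v => by simp [h.last, start, code],
    fun v => by simp [h.done, start], by simp [start], by simp [h.out, start, CNOTCircuit.encode]⟩
  · intro v w
    rw [h.adj]
    simp only [RAMState.init, true_and]
    refine if_congr ⟨?_, fun hvw => ⟨v, w, hvw, rfl⟩⟩ rfl rfl
    rintro ⟨i, j, hij, he⟩
    have hn : 0 < n := v.pos
    -- Division by `n` recovers row and column from the index of a matrix entry.
    have h1 : (v : ℕ) = i := by
      have := congrArg (· / n) he
      simpa [Nat.add_div_of_dvd_right, Nat.div_eq_of_lt, hn, add_comm _ (w : ℕ),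
        add_comm _ (j : ℕ), Nat.add_mul_div_right] using this
    have h2 : (w : ℕ) = j := by rw [h1] at he; omega
    rwa [Fin.ext h1, Fin.ext h2]
  · intro v
    rw [h.label, if_pos v.2]
    rfl

/-- A bound on the time for `networkProgram`. -/
noncomputable def time : Polynomial ℕ := 100 * (Polynomial.X + 1) ^ 4

lemma labelTime_add_sweepTime_le (n : ℕ) : labelTime n + sweepTime n ≤ time.eval n := by
  simp only [labelTime, sweepTime, treatTime, roundTime, time, Polynomial.eval_mul,
    Polynomial.eval_pow, Polynomial.eval_add, Polynomial.eval_X, Polynomial.eval_one,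
    Polynomial.eval_ofNat]
  nlinarith [Nat.zero_le (n ^ 2), Nat.zero_le (n ^ 3), Nat.zero_le (n ^ 4)]

lemma mul_clog_le_time (n : ℕ) : n * Nat.clog 2 n ≤ time.eval n := by
  have hclog : Nat.clog 2 n ≤ n := (Nat.clog_le_iff_le_pow (by norm_num)).2 Nat.lt_two_pow_self.le
  have h1 : n * Nat.clog 2 n ≤ n * n := Nat.mul_le_mul_left n hclog
  refine h1.trans ?_
  simp only [time, Polynomial.eval_mul,
    Polynomial.eval_pow, Polynomial.eval_add, Polynomial.eval_X, Polynomial.eval_one,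
    Polynomial.eval_ofNat]
  nlinarith [Nat.zero_le (n ^ 2), Nat.zero_le (n ^ 3), Nat.zero_le (n ^ 4)]

theorem outputsWithin_networkProgram (hR : n * Nat.clog 2 n ≤ R) :
    networkProgram.OutputsWithin G (List.ofFn ω) (labelTime n + sweepTime n)
      (randomNetwork G ω) := by
  have h : Ends networkProgram (labelTime n + sweepTime n) (RAMState.init G (List.ofFn ω))
      fun s => s.out = (randomNetwork G ω).encode := by
    apply Ends.seq
    refine (ends_labelProgram hR).mono le_rfl fun s hs => ?_
    exact hs.rep.sweep.mono le_rfl fun s' hs' => hs'.out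
  exact h

end Sweep

theorem theorem3 :
    ∃ (P : RAMProgram) (T : Polynomial ℕ)
      (C : ∀ (n : ℕ) (G : SimpleGraph (Fin n)) [DecidableRel G.Adj],
        (Fin (T.eval n) → Bool) → CNOTCircuit (Fin n)),
      -- in polynomial time, `P` always produces a graphic parity network, namely `C n G ω`
      (∀ (n : ℕ) (G : SimpleGraph (Fin n)) [DecidableRel G.Adj] (ω : Fin (T.eval n) → Bool),
        P.OutputsWithin G (List.ofFn ω) (T.eval n) (C n G ω) ∧
          (C n G ω).IsGraphicParityNetwork G) ∧
      -- its expected size on all graphs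
      (∃ K : ℝ, ∀ (n : ℕ) (G : SimpleGraph (Fin n)) [DecidableRel G.Adj],
        expectedSize (C n G) ≤
          (G.edgeFinset.card : ℝ) + K * ((n : ℝ) ^ (3 / 2 : ℝ) * √(Real.log n))) ∧
      -- its expected size if all but at most `c₁` vertices have degree at least `c₂ * n`
      (∀ (c₁ : ℕ) (c₂ : ℝ), 0 < c₂ → ∃ K : ℝ,
        ∀ (n : ℕ) (G : SimpleGraph (Fin n)) [DecidableRel G.Adj],
          (Finset.univ.filter fun v : Fin n => (G.degree v : ℝ) < c₂ * n).card ≤ c₁ →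
            expectedSize (C n G) ≤ (G.edgeFinset.card : ℝ) + K * (n * Real.log n)) := by
  -- The polynomial serves both as time bound and as number of coins; only the first `n * Nat.clog 2
  -- n` coins are used.
  refine ⟨Sweep.networkProgram, Sweep.time, fun n G _ ω => Sweep.randomNetwork G ω, ?_, ?_, ?_⟩
  · intro n G _ ω
    refine ⟨?_, Sweep.isGraphicParityNetwork_network G (Sweep.coinLabel_clog_lt ω)⟩
    obtain ⟨t, ht, s, hs⟩ :=
      Sweep.outputsWithin_networkProgram (G := G) (ω := ω) (Sweep.mul_clog_le_time n)
    exact ⟨t, ht.trans (Sweep.labelTime_add_sweepTime_le n), s, hs⟩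
  · refine ⟨26, fun n G _ => ?_⟩
    exact Finset.expect_le Finset.univ_nonempty fun ω _ => Sweep.length_randomNetwork_le G ω
  · intro c₁ c₂ hc₂
    exact ⟨22 + 4 * c₁ + 16 / c₂, fun n G _ hdeg =>
      Sweep.expectedSize_randomNetwork_le G (Sweep.mul_clog_le_time n) hc₂ hdeg⟩
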